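/- Let $N\ge 2$ and $k\ge l\ge 0$ be integers and $G=SL(N,\mathbb C)$. Let $S^k\mathbb C^N$ be the space of homogeneous polynomials of degree $k$ in $\mathbb C[x_1,\dots,x_N]$, with the action induced by the standard representation of $G$, and let $S^l(\mathbb C^N)^*$ be the space of homogeneous polynomials of degree $l$ in $\mathbb C[\partial_1,\dots,\partial_N]$, with the action induced by the dual of the standard representation, where $\partial_i(x_j)=\delta_{ij}$. Define $$\mathrm{div}: S^k\mathbb C^N\otimes S^l(\mathbb C^N)^*\to S^{k-l}\mathbb C^N,\qquad P\otimes Q\mapsto Q(\partial_1,\dots,\partial_N)(P).$$ Let $\omega_1$ be the first fundamental weight of $\mathfrak{sl}(N,\mathbb C)$ (with respect to the diagonal Cartan subalgebra and the positive roots $\epsilon_i-\epsilon_j$, $i<j$), and let $V(\lambda)$ denote the finite dimensional irreducible holomorphic representation of $G$ with highest weight $\lambda$. Then $S^{k-l}\mathbb C^N$ is a model of $V((k-l)\omega_1)$, the representation $S^k\mathbb C^N\otimes S^l(\mathbb C^N)^*$ is completely reducible, and $\mathrm{div}$ is $G$-equivariant. Moreover, $V((k-l)\omega_1)$ occurs in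 $S^k\mathbb C^N\otimes S^l(\mathbb C^N)^*$ with multiplicity exactly one, i.e. $\dim\mathrm{Hom}_G\big(S^k\mathbb C^N\otimes S^l(\mathbb C^N)^*,V((k-l)\omega_1)\big)=1$; the restriction of $\mathrm{div}$ to the $V((k-l)\omega_1)$-isotypic component is an isomorphism onto $S^{k-l}\mathbb C^N$; and $\mathrm{div}$ is zero on the $W$-isotypic component for every irreducible representation $W$ of $G$ that is not equivalent to $V((k-l)\omega_1)$. -/

import Mathlib

attribute [local instance 100] LieRing.ofAssociativeRing

noncomputable section

namespace SLRep

open MvPolynomial TensorProduct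

/-- The special linear group `SL(N, ℂ)`. -/
abbrev SL (N : ℕ) : Type := Matrix.SpecialLinearGroup (Fin N) ℂ

/-- The Lie algebra `𝔰𝔩(N, ℂ)` of traceless matrices. -/
abbrev slAlg (N : ℕ) : LieSubalgebra ℂ (Matrix (Fin N) (Fin N) ℂ) :=
  LieAlgebra.SpecialLinear.sl (Fin N) ℂ

section Weights

/-- The Cartan subalgebra `𝔥` of diagonal matrices in `𝔰𝔩(N, ℂ)`. -/
def cartan (N : ℕ) : Submodule ℂ (slAlg N) where
  carrier := {H | ∀ i j, i ≠ j → (H : Matrix (Fin N) (Fin N) ℂ) i j = 0}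
  add_mem' := by
    intro a b ha hb i j hij
    have h1 := ha i j hij
    have h2 := hb i j hij
    simp [h1, h2]
  zero_mem' := by
    intro i j _
    simp
  smul_mem' := by
    intro c a ha i j hij
    have h1 := ha i j hij
    simp [h1]

/-- The functional `ε_j : diag(φ₁, …, φ_N) ↦ φ_j` on `𝔥`. -/
def epsilon (N : ℕ) (j : Fin N) : Module.Dual ℂ (cartan N) where
  toFun H := ((H : slAlg N) : Matrix (Fin N) (Fin N) ℂ) j j
  map_add' _ _ := by simp
  map_smul' _ _ := by simp

/-- The fundamental weight `ω_i = ε_1 + ⋯ + ε_i` (`1 ≤ i ≤ N - 1`); see `fundamentalWeight_coroot`. -/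
def fundamentalWeight (N i : ℕ) : Module.Dual ℂ (cartan N) :=
  ∑ j ∈ Finset.univ.filter (fun j : Fin N => (j : ℕ) < i), epsilon N j

/-- The coroot `H_α = E_aa - E_bb` of the root `α = ε_a - ε_b`. -/
def coroot {N : ℕ} (a b : Fin N) : cartan N :=
  ⟨⟨Matrix.diagonal (Pi.single a 1 - Pi.single b 1), by
      simp [LieAlgebra.SpecialLinear.sl, Matrix.trace_diagonal]⟩,
    fun _ _ hij => Matrix.diagonal_apply_ne _ hij⟩

/-- `ω_i (H_{α_j}) = δ_{ij}` for the simple roots `α_j = ε_j - ε_{j+1}`, `1 ≤ j ≤ N - 1`: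
this is the defining property of the fundamental weights. -/
theorem fundamentalWeight_coroot {N i j : ℕ} (hi : 1 ≤ i) (hj : 1 ≤ j) (hjN : j < N) :
    fundamentalWeight N i (coroot ⟨j - 1, by omega⟩ ⟨j, hjN⟩) = if i = j then 1 else 0 := by
  have h : ∀ x : Fin N, epsilon N x (coroot ⟨j - 1, by omega⟩ ⟨j, hjN⟩)
      = (if x = (⟨j - 1, by omega⟩ : Fin N) then 1 else 0)
        - (if x = (⟨j, hjN⟩ : Fin N) then 1 else 0) := by
    intro x
    change Matrix.diagonal _ x x = _
    rw [Matrix.diagonal_apply_eq, Pi.sub_apply, Pi.single_apply, Pi.single_apply]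
  rw [fundamentalWeight, LinearMap.sum_apply, Finset.sum_congr rfl (fun x _ => h x),
    Finset.sum_sub_distrib, Finset.sum_ite_eq', Finset.sum_ite_eq']
  simp only [Finset.mem_filter, Finset.mem_univ, true_and]
  split_ifs <;> first | omega | simp

end Weights

section General

variable {G : Type*} [Group G] {V W : Type*} [AddCommMonoid V] [Module ℂ V]
  [AddCommMonoid W] [Module ℂ W]

/-- The `σ`-isotypic component of `ρ`: the sum of all subrepresentations of `ρ` that are
equivalent to `σ`. -/
def isotypic (ρ : Representation ℂ G V) (σ : Representation ℂ G W) : Submodule ℂ V :=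
  ⨆ (U : Subrepresentation ρ) (_ : Nonempty (U.toRepresentation.Equiv σ)), U.toSubmodule

/-- The multiplicity of the irreducible representation `σ` in `ρ`: the dimension of
`Hom_G(V, W)`. -/
def multiplicity (ρ : Representation ℂ G V) (σ : Representation ℂ G W) : ℕ :=
  Module.finrank ℂ (ρ.IntertwiningMap σ)

end General

section HighestWeight

variable {N : ℕ} {V : Type*} [AddCommGroup V] [Module ℂ V]

/-- `D` is the differential at the identity of the representation `ρ`, that is,
`D(X) v = d/dt ρ(exp(tX)) v` at `t = 0` for all `X ∈ 𝔰𝔩(N, ℂ)` and `v ∈ V`, with `t` complex;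
on a finite dimensional `V` convergence is tested on linear functionals. A finite dimensional
representation has such a (complex linear) differential exactly when it is holomorphic. -/
def IsDifferential (ρ : Representation ℂ (SL N) V) (D : slAlg N →ₗ⁅ℂ⁆ Module.End ℂ V) : Prop :=
  ∀ (X : slAlg N) (γ : ℂ → SL N),
    (∀ t : ℂ, (γ t : Matrix (Fin N) (Fin N) ℂ) =
      NormedSpace.exp (t • (X : Matrix (Fin N) (Fin N) ℂ))) →
    ∀ (v : V) (f : Module.Dual ℂ V), HasDerivAt (fun t => f (ρ (γ t) v)) (f (D X v)) 0

/-- `(ρ, V)` is a model of `V(wt)`: a finite dimensional irreducible holomorphic representation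
of `SL(N, ℂ)` with highest weight `wt`, i.e. with a nonzero vector of weight `wt` that is
annihilated by the root vectors `E_ij`, `i < j`, of the positive roots `ε_i - ε_j`. -/
structure IsHighestWeightRep (ρ : Representation ℂ (SL N) V)
    (wt : Module.Dual ℂ (cartan N)) : Prop where
  finiteDimensional : FiniteDimensional ℂ V
  irreducible : ρ.IsIrreducible
  exists_highest : ∃ D : slAlg N →ₗ⁅ℂ⁆ Module.End ℂ V, IsDifferential ρ D ∧
    ∃ v : V, v ≠ 0 ∧ (∀ H : cartan N, D (H : slAlg N) v = wt H • v) ∧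
      ∀ (i j : Fin N) (hij : i < j),
        D (LieAlgebra.SpecialLinear.single i j hij.ne (1 : ℂ)) v = 0

end HighestWeight

section Sym

/-- The linear substitution `x_j ↦ ∑ i, A_ij x_i`, i.e. the algebra endomorphism of
`ℂ[x_1, …, x_N]` induced by the linear map `A` on the span of the variables. -/
def subst {N : ℕ} (A : Matrix (Fin N) (Fin N) ℂ) :
    MvPolynomial (Fin N) ℂ →ₐ[ℂ] MvPolynomial (Fin N) ℂ :=
  aeval fun j => ∑ i, A i j • X i

theorem subst_one {N : ℕ} : subst (1 : Matrix (Fin N) (Fin N) ℂ) = AlgHom.id ℂ _ := by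
  apply MvPolynomial.algHom_ext
  intro j
  simp [subst, Matrix.one_apply]

theorem subst_mul {N : ℕ} (A B : Matrix (Fin N) (Fin N) ℂ) :
    subst (A * B) = (subst A).comp (subst B) := by
  apply MvPolynomial.algHom_ext
  intro j
  simp only [subst, aeval_X, AlgHom.comp_apply, map_sum, map_smul, Matrix.mul_apply,
    Finset.sum_smul, Finset.smul_sum, smul_smul]
  rw [Finset.sum_comm]
  refine Finset.sum_congr rfl fun i _ => Finset.sum_congr rfl fun l _ => ?_
  rw [mul_comm]

/-- The symmetric power `S^k ℂ^N`, realised as the space of homogeneous polynomials of degree `k`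
in `x_1, …, x_N`. The same space, with `x_i` replaced by `∂_i`, realises `S^k (ℂ^N)^*`. -/
abbrev SymPow (N k : ℕ) : Submodule ℂ (MvPolynomial (Fin N) ℂ) :=
  homogeneousSubmodule (Fin N) ℂ k

theorem subst_mem {N k : ℕ} (A : Matrix (Fin N) (Fin N) ℂ) :
    ∀ p ∈ SymPow N k, (subst A).toLinearMap p ∈ SymPow N k := by
  intro p hp
  have h := ((mem_homogeneousSubmodule k p).1 hp).aeval (S := ℂ) (n := 1)
    (fun j : Fin N => ∑ i, A i j • (X i : MvPolynomial (Fin N) ℂ))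
    (fun j => (homogeneousSubmodule (Fin N) ℂ 1).sum_mem fun i _ =>
      Submodule.smul_mem _ _ ((mem_homogeneousSubmodule 1 _).2 (isHomogeneous_X ℂ i)))
  rw [one_mul] at h
  exact (mem_homogeneousSubmodule k _).2 h

/-- The representation of `SL(N, ℂ)` on `S^k ℂ^N` induced by the standard one,
`g x_j = ∑ i, g_ij x_i`. -/
def symRep (N k : ℕ) : Representation ℂ (SL N) (SymPow N k) where
  toFun g := (subst (g : Matrix (Fin N) (Fin N) ℂ)).toLinearMap.restrict (subst_mem _)
  map_one' := by
    ext p : 2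
    simp [subst_one]
  map_mul' g h := by
    ext p : 2
    simp [subst_mul]

/-- The representation of `SL(N, ℂ)` on `S^l (ℂ^N)^*` induced by the dual of the standard one,
`g ∂_j = ∂_j ∘ g⁻¹ = ∑ i, (g⁻¹)_ji ∂_i`. -/
def symDualRep (N l : ℕ) : Representation ℂ (SL N) (SymPow N l) where
  toFun g :=
    (subst ((g⁻¹ : SL N) : Matrix (Fin N) (Fin N) ℂ).transpose).toLinearMap.restrict (subst_mem _)
  map_one' := by
    ext p : 2
    simp [subst_one]
  map_mul' g h := by
    ext p : 2
    simp only [mul_inv_rev, Matrix.SpecialLinearGroup.coe_mul, Matrix.transpose_mul, subst_mul]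
    rfl

/-- The representation of `SL(N, ℂ)` on `S^k ℂ^N ⊗ S^l (ℂ^N)^*`. -/
def tensorRep (N k l : ℕ) : Representation ℂ (SL N) (SymPow N k ⊗[ℂ] SymPow N l) :=
  (symRep N k).tprod (symDualRep N l)

/-- The monomial differential operator `∂_1^{m_1} ⋯ ∂_N^{m_N}`. -/
def partialMonomial {N : ℕ} (m : Fin N →₀ ℕ) : Module.End ℂ (MvPolynomial (Fin N) ℂ) :=
  ((List.finRange N).map fun i =>
    ((pderiv i : Derivation ℂ (MvPolynomial (Fin N) ℂ) (MvPolynomial (Fin N) ℂ)) :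
      Module.End ℂ (MvPolynomial (Fin N) ℂ)) ^ m i).prod

/-- The constant coefficient differential operator `Q(∂_1, …, ∂_N)`. -/
def diffOp {N : ℕ} :
    MvPolynomial (Fin N) ℂ →ₗ[ℂ] Module.End ℂ (MvPolynomial (Fin N) ℂ) :=
  (basisMonomials (Fin N) ℂ).constr ℂ partialMonomial

theorem pderiv_pow_mem {N k : ℕ} (i : Fin N) (n : ℕ) (p : MvPolynomial (Fin N) ℂ)
    (hp : p ∈ SymPow N k) :
    (((pderiv i : Derivation ℂ (MvPolynomial (Fin N) ℂ) (MvPolynomial (Fin N) ℂ)) :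
      Module.End ℂ (MvPolynomial (Fin N) ℂ)) ^ n) p ∈ SymPow N (k - n) := by
  induction n with
  | zero => simpa using hp
  | succ n ih =>
    rw [pow_succ', Module.End.mul_apply]
    exact ((mem_homogeneousSubmodule _ _).1 ih).pderiv

theorem partialMonomial_mem {N k : ℕ} (m : Fin N →₀ ℕ) (p : MvPolynomial (Fin N) ℂ)
    (hp : p ∈ SymPow N k) : partialMonomial m p ∈ SymPow N (k - m.degree) := by
  have h : ∀ L : List (Fin N), (L.map fun i =>
      ((pderiv i : Derivation ℂ (MvPolynomial (Fin N) ℂ) (MvPolynomial (Fin N) ℂ)) :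
        Module.End ℂ (MvPolynomial (Fin N) ℂ)) ^ m i).prod p
      ∈ SymPow N (k - (L.map m).sum) := by
    intro L
    induction L with
    | nil => simpa using hp
    | cons a L ih =>
      simp only [List.map_cons, List.sum_cons]
      rw [add_comm, ← Nat.sub_sub, List.prod_cons, Module.End.mul_apply]
      exact pderiv_pow_mem a (m a) _ ih
  have hd : m.degree = ((List.finRange N).map m).sum := by
    rw [Finsupp.degree_eq_sum, ← List.ofFn_eq_map, List.sum_ofFn]
  rw [hd]
  exact h _

theorem diffOp_mem {N k l : ℕ} (q p : MvPolynomial (Fin N) ℂ) (hq : q ∈ SymPow N l)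
    (hp : p ∈ SymPow N k) : diffOp q p ∈ SymPow N (k - l) := by
  rw [diffOp, Module.Basis.constr_apply, Finsupp.sum, LinearMap.sum_apply]
  refine Submodule.sum_mem _ fun m hm => ?_
  rw [LinearMap.smul_apply]
  refine Submodule.smul_mem _ _ ?_
  have hdeg : m.degree = l := by
    have h1 : coeff m q ≠ 0 := Finsupp.mem_support_iff.1 hm
    have h2 := (mem_homogeneousSubmodule l q).1 hq h1
    rw [← h2]
    exact DFunLike.congr_fun (Finsupp.degree_eq_weight_one (R := ℕ)) m
  rw [← hdeg]
  exact partialMonomial_mem m p hp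

/-- The map `div : S^k ℂ^N ⊗ S^l (ℂ^N)^* → S^{k-l} ℂ^N`, `P ⊗ Q ↦ Q(∂_1, …, ∂_N) P`
(to be used for `l ≤ k`). -/
def div (N k l : ℕ) : (SymPow N k ⊗[ℂ] SymPow N l) →ₗ[ℂ] SymPow N (k - l) :=
  TensorProduct.lift <| LinearMap.mk₂ ℂ
    (fun (P : SymPow N k) (Q : SymPow N l) =>
      (⟨diffOp (Q : MvPolynomial (Fin N) ℂ) (P : MvPolynomial (Fin N) ℂ),
        diffOp_mem _ _ Q.2 P.2⟩ : SymPow N (k - l)))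
    (fun _ _ _ => Subtype.ext (by simp))
    (fun _ _ _ => Subtype.ext (by simp))
    (fun _ _ _ => Subtype.ext (by simp))
    (fun _ _ _ => Subtype.ext (by simp))

end Sym

end SLRep

end

/-! The core is that an equivariant map T : S^k ⊗ (S^l)^* → S^m with k = m + l is determined by a
single number. Fix a variable x_z and follow the coefficient of x_z^m in the values of T. Invariance
under the torus kills it on x^a ⊗ ∂^b unless a = b + m e_z (`topCoeff_weight`). The root vectors x_i
∂_z with i ≠ z link the surviving values, because no polynomial in the image of x_i ∂_z contains
x_z^m (`topCoeff_exchange`). All values are thus multiples of the one on x_z^k ⊗ ∂_z^l. If that one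
vanishes, T misses x_z^m, and T = 0 because S^m is irreducible (`intertwining_eq_zero`). Since div
is equivariant and nonzero, it spans Hom_G (`exists_eq_smul_divHom`).

Complete reducibility comes from the Fischer product ⟨p, q⟩ = (p̄(∂) q)(0), without averaging over
SU(N): the adjoint of g is its conjugate transpose, again an element of SL(N), so orthogonal
complements of invariant subspaces are invariant (`exists_orthogonal`). The orthogonal projection
onto any copy of S^(k-l) is then a multiple of div, which forces that copy to be the orthogonal
complement of ker div (`isotypic_eq_perp_ker`). Other irreducible types go to zero by Schur's lemma
(`isotypic_le_ker`).

An arbitrary model of V((k-l)ω₁) is identified with S^(k-l) by `IsHighestWeightRep.equiv`: in V × W,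
the submodule generated by the pair of highest weight vectors is the graph of an equivalence.
Invariant subspaces for the group and for the Lie algebra are matched by `HasDiff.mem` and
`stable_of_hasDiff`. -/

noncomputable section

namespace SLRep

open MvPolynomial TensorProduct

/-! ### Differentials along curves in the group, tested on linear functionals -/

section HasDiff

variable {G : Type*} [Group G] {V W : Type*} [AddCommGroup V] [Module ℂ V]
  [AddCommGroup W] [Module ℂ W]

/-- The derivative at `0` of `ρ` along the curve `γ` is `A`, tested on linear functionals. -/
def HasDiff (ρ : Representation ℂ G V) (γ : ℂ → G) (A : Module.End ℂ V) : Prop :=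
  ∀ (v : V) (f : Module.Dual ℂ V), HasDerivAt (fun t => f (ρ (γ t) v)) (f (A v)) 0

variable {ρ : Representation ℂ G V} {σ : Representation ℂ G W} {γ : ℂ → G}
  {A : Module.End ℂ V} {B : Module.End ℂ W}

/-- Otherwise a functional vanishing on U separates `A v` from U; along the orbit it is constantly
zero, so its derivative `f (A v)` is zero too. -/
theorem HasDiff.mem (h : HasDiff ρ γ A) (U : Submodule ℂ V) (hU : ∀ g, ∀ v ∈ U, ρ g v ∈ U)
    {v : V} (hv : v ∈ U) : A v ∈ U := by
  by_contra hc
  obtain ⟨f, hf, hfU⟩ := U.exists_le_ker_of_notMem hc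
  have h1 := h v f
  have h2 : (fun t => f (ρ (γ t) v)) = fun _ => 0 := by
    funext t
    exact hfU (hU _ _ hv)
  rw [h2] at h1
  exact hf (h1.unique (hasDerivAt_const _ _))

theorem HasDiff.intertwine (h : HasDiff ρ γ A) (h' : HasDiff σ γ B)
    (T : ρ.IntertwiningMap σ) (v : V) : T (A v) = B (T v) := by
  rw [← sub_eq_zero]
  refine (Module.forall_dual_apply_eq_zero_iff ℂ _).1 fun f => ?_
  have h1 := h v (f ∘ₗ T.toLinearMap)
  have h2 := h' (T v) f
  have h3 : (fun t => (f ∘ₗ T.toLinearMap) (ρ (γ t) v)) = fun t => f (σ (γ t) (T v)) := by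
    funext t
    simp [T.isIntertwining]
  rw [h3] at h1
  rw [map_sub, sub_eq_zero]
  exact h1.unique h2

theorem HasDiff.prod (h : HasDiff ρ γ A) (h' : HasDiff σ γ B) :
    HasDiff (ρ.prod σ) γ (A.prodMap B) := by
  intro v f
  have h1 := (h v.1 (f ∘ₗ LinearMap.inl ℂ V W)).add (h' v.2 (f ∘ₗ LinearMap.inr ℂ V W))
  have key : ∀ (a : V) (b : W), f (a, b) = f (a, 0) + f (0, b) := fun a b => by
    rw [← map_add]; simp
  exact (h1.congr_deriv (key _ _).symm).congr_of_eventuallyEq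
    (Filter.Eventually.of_forall fun t => key _ _)

/-- Expanding `f` in bases of the factors turns it into a finite sum of products of scalar
functions, to which the ordinary product rule applies. -/
theorem HasDiff.tprod [FiniteDimensional ℂ V] [FiniteDimensional ℂ W]
    (hγ : γ 0 = 1) (h : HasDiff ρ γ A) (h' : HasDiff σ γ B) :
    HasDiff (ρ.tprod σ) γ (TensorProduct.map A LinearMap.id + TensorProduct.map LinearMap.id B) := by
  intro v f
  induction v with
  | zero => simpa using hasDerivAt_const (0 : ℂ) (0 : ℂ)
  | add x y hx hy =>
    simp only [map_add]
    exact hx.add hy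
  | tmul p q =>
    let b := Module.finBasis ℂ V
    let c := Module.finBasis ℂ W
    have key : ∀ x y, f (x ⊗ₜ[ℂ] y) = ∑ i, ∑ j, b.coord i x * c.coord j y * f (b i ⊗ₜ c j) := by
      intro x y
      conv_lhs => rw [← b.sum_repr x, ← c.sum_repr y]
      simp only [sum_tmul, map_sum, ← smul_tmul', tmul_sum, tmul_smul, map_smul, smul_eq_mul,
        Module.Basis.coord_apply, mul_assoc, Finset.mul_sum]
      rw [Finset.sum_comm]
      exact Finset.sum_congr rfl fun i _ => Finset.sum_congr rfl fun j _ => mul_left_comm _ _ _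
    have h1 : HasDerivAt (fun t => ∑ i, ∑ j, b.coord i (ρ (γ t) p) * c.coord j (σ (γ t) q)
        * f (b i ⊗ₜ c j)) (∑ i, ∑ j, (b.coord i (A p) * c.coord j q + b.coord i p * c.coord j (B q))
        * f (b i ⊗ₜ c j)) 0 := by
      refine HasDerivAt.fun_sum fun i _ => HasDerivAt.fun_sum fun j _ => ?_
      have := ((h p (b.coord i)).mul (h' q (c.coord j))).mul_const (f (b i ⊗ₜ c j))
      simpa [hγ] using this
    refine (h1.congr_deriv ?_).congr_of_eventuallyEq (Filter.Eventually.of_forall fun t => ?_)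
    · rw [LinearMap.add_apply, TensorProduct.map_tmul, TensorProduct.map_tmul, map_add, key, key]
      simp only [LinearMap.id_apply, add_mul, Finset.sum_add_distrib]
    · exact key _ _

theorem HasDiff.hasDerivAt (h : HasDiff ρ γ A) (hadd : ∀ s t, γ (s + t) = γ s * γ t) (v : V)
    (f : Module.Dual ℂ V) (s : ℂ) :
    HasDerivAt (fun t => f (ρ (γ t) v)) (f (ρ (γ s) (A v))) s := by
  have h1 := h v (f ∘ₗ ρ (γ s))
  have h2 : (fun t => f (ρ (γ t) v)) = fun t => (f ∘ₗ ρ (γ s)) (ρ (γ (t - s)) v) := by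
    funext t
    rw [LinearMap.comp_apply, ← Module.End.mul_apply, ← map_mul, ← hadd, add_sub_cancel]
  rw [h2]
  have h3 : HasDerivAt (fun t => (f ∘ₗ ρ (γ s)) (ρ (γ t) v)) ((f ∘ₗ ρ (γ s)) (A v)) (s - s) := by
    simpa using h1
  exact h3.comp_sub_const s s

theorem HasDiff.iteratedDeriv (h : HasDiff ρ γ A)
    (hadd : ∀ s t, γ (s + t) = γ s * γ t) (v : V) (f : Module.Dual ℂ V) (n : ℕ) :
    iteratedDeriv n (fun t => f (ρ (γ t) v)) = fun t => f (ρ (γ t) ((A ^ n) v)) := by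
  induction n generalizing v with
  | zero => simp
  | succ n ih =>
    rw [iteratedDeriv_succ, ih]
    funext s
    rw [(h.hasDerivAt hadd _ _ s).deriv, pow_succ', Module.End.mul_apply]

/-- For a functional `f` vanishing on U, `t ↦ f (ρ (γ t) v)` is entire with Taylor coefficients
proportional to `f (A ^ n v) = 0`, hence identically zero. -/
theorem HasDiff.stable (h : HasDiff ρ γ A) (h0 : γ 0 = 1)
    (hadd : ∀ s t, γ (s + t) = γ s * γ t) (U : Submodule ℂ V) (hU : ∀ v ∈ U, A v ∈ U)
    {v : V} (hv : v ∈ U) (t : ℂ) : ρ (γ t) v ∈ U := by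
  by_contra hc
  obtain ⟨f, hf, hfU⟩ := U.exists_le_ker_of_notMem hc
  apply hf
  have hpow : ∀ n, (A ^ n) v ∈ U := fun n => by
    induction n with
    | zero => simpa
    | succ n ih => rw [pow_succ', Module.End.mul_apply]; exact hU _ ih
  have hdiff : Differentiable ℂ fun t => f (ρ (γ t) v) := fun s =>
    (h.hasDerivAt hadd v f s).differentiableAt
  rw [← Complex.taylorSeries_eq_of_entire (c := 0) hdiff t]
  simp only [h.iteratedDeriv hadd, h0, map_one, Module.End.one_apply]
  have : ∀ n, f ((A ^ n) v) = 0 := fun n => hfU (hpow n)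
  simp [this]

end HasDiff

/-! ### One-parameter subgroups and generation of SL(N) by exponentials -/

section OneParam

variable {N : ℕ}

/-- `γ` is the one-parameter subgroup `t ↦ exp(tX)`. -/
def IsOneParam (γ : ℂ → SL N) (X : Matrix (Fin N) (Fin N) ℂ) : Prop :=
  ∀ t : ℂ, (γ t : Matrix (Fin N) (Fin N) ℂ) = NormedSpace.exp (t • X)

variable {γ : ℂ → SL N} {X : Matrix (Fin N) (Fin N) ℂ}

theorem IsOneParam.zero (h : IsOneParam γ X) : γ 0 = 1 := by
  apply Subtype.ext
  rw [h 0]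
  simp

theorem IsOneParam.add (h : IsOneParam γ X) (s t : ℂ) : γ (s + t) = γ s * γ t := by
  apply Subtype.ext
  rw [h, Matrix.SpecialLinearGroup.coe_mul, h, h, add_smul, Matrix.exp_add_of_commute]
  exact ((Commute.refl X).smul_left s).smul_right t

section
attribute [local instance] Matrix.linftyOpNormedRing Matrix.linftyOpNormedAlgebra

theorem hasDerivAt_exp_entry (X : Matrix (Fin N) (Fin N) ℂ) (i j : Fin N) :
    HasDerivAt (fun t : ℂ => NormedSpace.exp (t • X) i j) (X i j) 0 := by
  have h := hasDerivAt_exp_smul_const (𝕂 := ℂ) X (0 : ℂ)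
  rw [zero_smul, NormedSpace.exp_zero, one_mul] at h
  let e : Matrix (Fin N) (Fin N) ℂ →ₗ[ℂ] ℂ := Matrix.entryLinearMap ℂ ℂ i j
  exact (LinearMap.toContinuousLinearMap e).hasFDerivAt.comp_hasDerivAt (0 : ℂ) h
end

theorem IsOneParam.hasDerivAt (h : IsOneParam γ X) (i j : Fin N) :
    HasDerivAt (fun t : ℂ => (γ t : Matrix (Fin N) (Fin N) ℂ) i j) (X i j) 0 := by
  simpa only [h _] using hasDerivAt_exp_entry X i j

theorem IsOneParam.hasDerivAt_inv_transpose (h : IsOneParam γ X) (i j : Fin N) :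
    HasDerivAt (fun t : ℂ => ((γ t)⁻¹ : SL N).1.transpose i j) (-X.transpose i j) 0 := by
  have h1 : ∀ t, (γ t)⁻¹ = γ (-t) := fun t => by
    rw [inv_eq_iff_mul_eq_one, ← h.add, add_neg_cancel, h.zero]
  simp only [h1, Matrix.transpose_apply]
  have h2 : HasDerivAt (fun t : ℂ => (γ t : Matrix (Fin N) (Fin N) ℂ) j i) (X j i) (-0) := by
    simpa using h.hasDerivAt j i
  exact (h2.scomp (0 : ℂ) (hasDerivAt_neg (0 : ℂ))).congr_deriv (by simp)

theorem exp_smul_single {i j : Fin N} (hij : i ≠ j) (t c : ℂ) :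
    NormedSpace.exp (t • Matrix.single i j c) = Matrix.transvection i j (t * c) := by
  have hsq : (t • Matrix.single i j c) ^ 2 = 0 := by
    rw [pow_two, Matrix.smul_single, Matrix.single_mul_single_of_ne _ _ _ _ hij.symm]
  rw [NormedSpace.exp_eq_tsum_rat]
  beta_reduce
  rw [tsum_eq_sum (s := Finset.range 2)]
  · simp [Finset.sum_range_succ, Matrix.transvection, Matrix.smul_single]
  · intro n hn
    obtain ⟨k, rfl⟩ := Nat.exists_eq_add_of_le (show 2 ≤ n by simpa [Nat.lt_iff_add_one_le] using hn)
    rw [pow_add, hsq]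
    simp

theorem exists_oneParam_single {i j : Fin N} (hij : i ≠ j) (c : ℂ) :
    ∃ γ : ℂ → SL N, IsOneParam γ (Matrix.single i j c) :=
  ⟨fun t => Matrix.SpecialLinearGroup.transvection hij (t * c), fun t => by
    rw [exp_smul_single hij]; rfl⟩

theorem exists_oneParam_diagonal (v : Fin N → ℂ) (hv : ∑ i, v i = 0) :
    ∃ γ : ℂ → SL N, IsOneParam γ (Matrix.diagonal v) := by
  have h : ∀ t : ℂ, (NormedSpace.exp (t • Matrix.diagonal v)) =
      Matrix.diagonal fun i => Complex.exp (t * v i) := by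
    intro t
    rw [← Matrix.diagonal_smul, Matrix.exp_diagonal]
    congr 1
    funext i
    rw [Pi.coe_exp, Complex.exp_eq_exp_ℂ]
    rfl
  refine ⟨fun t => ⟨NormedSpace.exp (t • Matrix.diagonal v), ?_⟩, fun t => rfl⟩
  rw [h, Matrix.det_diagonal, ← Complex.exp_sum, ← Finset.mul_sum, hv]
  simp

/-- A subspace that is stable under the differential is stable under the group. -/
theorem stable_of_hasDiff {V : Type*} [AddCommGroup V] [Module ℂ V]
    {ρ : Representation ℂ (SL N) V} {D : slAlg N → Module.End ℂ V} (hN : 2 ≤ N)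
    (hD : ∀ (X : slAlg N) (γ : ℂ → SL N), IsOneParam γ X → HasDiff ρ γ (D X))
    (U : Submodule ℂ V) (hU : ∀ X, ∀ v ∈ U, D X v ∈ U) (g : SL N) :
    ∀ v ∈ U, ρ g v ∈ U := by
  have hexp : ∀ (X : slAlg N) (γ : ℂ → SL N), IsOneParam γ X → ∀ v ∈ U, ρ (γ 1) v ∈ U :=
    fun X γ hγ v hv => (hD X γ hγ).stable hγ.zero hγ.add U (hU X) hv 1
  -- The induction on diagonal matrices and transvections runs over all matrices, so the determinant
  -- condition is carried inside the motive.
  suffices h : ∃ h : (g : Matrix (Fin N) (Fin N) ℂ).det = 1, ∀ v ∈ U, ρ ⟨g, h⟩ v ∈ U from h.2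
  refine Matrix.diagonal_transvection_induction
    (fun M => ∃ h : M.det = 1, ∀ v ∈ U, ρ ⟨M, h⟩ v ∈ U) g.1 ?_ ?_ ?_
  · intro d hd
    have hd1 : (Matrix.diagonal d).det = 1 := hd.trans g.2
    refine ⟨hd1, ?_⟩
    rw [Matrix.det_diagonal] at hd1
    have hne : ∀ i, d i ≠ 0 := fun i hi => by
      rw [Finset.prod_eq_zero (Finset.mem_univ i) hi] at hd1
      exact zero_ne_one hd1
    let z : Fin N := ⟨0, by omega⟩
    -- A traceless logarithm of `d`: principal logarithms off `z`, and at `z` minus their sum, which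
    -- exponentiates to `d z` because the product of the entries is 1.
    let v : Fin N → ℂ := fun i =>
      if i = z then -∑ j ∈ Finset.univ.erase z, Complex.log (d j) else Complex.log (d i)
    have hvz : ∀ j ∈ Finset.univ.erase z, v j = Complex.log (d j) := fun j hj =>
      if_neg (Finset.ne_of_mem_erase hj)
    have hv : ∑ i, v i = 0 := by
      rw [← Finset.add_sum_erase _ _ (Finset.mem_univ z), Finset.sum_congr rfl hvz]
      simp [v]
    have hexpv : ∀ i, Complex.exp (v i) = d i := by
      intro i
      by_cases hi : i = z
      · rw [← Finset.mul_prod_erase _ _ (Finset.mem_univ z)] at hd1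
        simp only [v, hi, if_true, Complex.exp_neg, Complex.exp_sum]
        rw [Finset.prod_congr rfl fun j _ => Complex.exp_log (hne j)]
        exact inv_eq_of_mul_eq_one_left hd1
      · simp only [v, hi, if_false]
        exact Complex.exp_log (hne i)
    obtain ⟨γ, hγ⟩ := exists_oneParam_diagonal v hv
    intro w hw
    have h1 : γ 1 = ⟨Matrix.diagonal d, hd.trans g.2⟩ := by
      apply Subtype.ext
      rw [hγ 1, one_smul, Matrix.exp_diagonal]
      congr 1
      funext i
      rw [Pi.coe_exp, ← hexpv i, Complex.exp_eq_exp_ℂ]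
    rw [← h1]
    exact hexp ⟨Matrix.diagonal v, by
      simpa [LieAlgebra.SpecialLinear.sl, Matrix.trace_diagonal] using hv⟩ γ hγ w hw
  · intro t
    refine ⟨t.det, ?_⟩
    obtain ⟨γ, hγ⟩ := exists_oneParam_single t.hij t.c
    have h1 : γ 1 = ⟨t.toMatrix, t.det⟩ := by
      apply Subtype.ext
      rw [hγ 1, exp_smul_single t.hij, one_mul]
      rfl
    rw [← h1]
    exact hexp (LieAlgebra.SpecialLinear.single t.i t.j t.hij t.c) γ hγ
  · rintro A B ⟨hA, hAU⟩ ⟨hB, hBU⟩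
    refine ⟨by rw [Matrix.det_mul, hA, hB, one_mul], fun v hv => ?_⟩
    let a : SL N := ⟨A, hA⟩
    let b : SL N := ⟨B, hB⟩
    change ρ (a * b) v ∈ U
    rw [map_mul]
    exact hAU _ (hBU _ hv)

end OneParam

/-! ### The submodule generated by a highest weight vector -/

section Unique

variable {N : ℕ}

/-- `𝔰𝔩(N, ℂ)` is spanned by the Cartan subalgebra and the root vectors. -/
theorem slAlg_eq_top {S : Submodule ℂ (slAlg N)} (hc : ∀ H : cartan N, (H : slAlg N) ∈ S)
    (hs : ∀ (i j : Fin N) (hij : i ≠ j), LieAlgebra.SpecialLinear.single i j hij (1 : ℂ) ∈ S)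
    (X : slAlg N) : X ∈ S := by
  let R : slAlg N := ∑ i, ∑ j, if hij : i ≠ j then
    X.1 i j • LieAlgebra.SpecialLinear.single i j hij (1 : ℂ) else 0
  have hR : R ∈ S := by
    refine S.sum_mem fun i _ => S.sum_mem fun j _ => ?_
    split_ifs with hij
    · exact S.smul_mem _ (hs i j hij)
    · exact S.zero_mem
  have hRv : ∀ a b, a ≠ b → R.1 a b = X.1 a b := by
    intro a b hab
    have h1 : R.1 = ∑ i, ∑ j, if i ≠ j then X.1 i j • Matrix.single i j (1 : ℂ) else 0 := by
      simp only [R, AddSubmonoidClass.coe_finsetSum]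
      refine Finset.sum_congr rfl fun i _ => Finset.sum_congr rfl fun j _ => ?_
      split_ifs <;> simp
    rw [h1, Matrix.sum_apply, Finset.sum_eq_single a, Matrix.sum_apply, Finset.sum_eq_single b]
    · simp [hab]
    · intro j _ hj
      split_ifs <;> simp [hj]
    · simp
    · intro i _ hi
      rw [Matrix.sum_apply]
      refine Finset.sum_eq_zero fun j _ => ?_
      split_ifs <;> simp [hi]
    · simp
  have hH : X - R ∈ S := hc ⟨X - R, fun i j hij => by
    simp [hRv i j hij]⟩
  simpa using S.add_mem hH hR

/-- The element `diag(N - 1, N - 3, …, 1 - N)` of the Cartan subalgebra. -/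
def gradingElement (N : ℕ) : cartan N :=
  ⟨⟨Matrix.diagonal fun i : Fin N => (N : ℂ) - 1 - 2 * (i : ℕ), by
    have h : ∀ n : ℕ, ∑ i ∈ Finset.range n, (i : ℂ) * 2 = n * (n - 1) := fun n => by
      induction n with
      | zero => simp
      | succ n ih => rw [Finset.sum_range_succ, ih]; push_cast; ring
    have h2 := Fin.sum_univ_eq_sum_range (fun i : ℕ => (i : ℂ) * 2) N
    simp only [LieAlgebra.SpecialLinear.sl, LieSubalgebra.mem_mk_iff', LinearMap.mem_ker,
      Matrix.traceLinearMap_apply, Matrix.trace_diagonal]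
    rw [Finset.sum_sub_distrib, Finset.sum_const]
    simp only [mul_comm (2 : ℂ), h2, h]
    simp⟩,
    fun _ _ hij => Matrix.diagonal_apply_ne _ hij⟩

/-- The eigenvalue is negative exactly for the lowering root vectors, so this one element suffices
to separate the highest weight from everything obtained by lowering. -/
theorem gradingElement_lie {i j : Fin N} (hij : i ≠ j) :
    ⁅(gradingElement N : slAlg N), LieAlgebra.SpecialLinear.single i j hij (1 : ℂ)⁆ =
      (2 * (j : ℕ) - 2 * (i : ℕ) : ℂ) • LieAlgebra.SpecialLinear.single i j hij (1 : ℂ) := by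
  apply Subtype.ext
  rw [LieAlgebra.SpecialLinear.sl_bracket]
  change Matrix.diagonal _ * Matrix.single i j 1 - Matrix.single i j 1 * Matrix.diagonal _ =
    (2 * (j : ℕ) - 2 * (i : ℕ) : ℂ) • Matrix.single i j (1 : ℂ)
  ext a b
  rw [Matrix.sub_apply, Matrix.diagonal_mul, Matrix.mul_diagonal, Matrix.smul_apply,
    Matrix.single_apply]
  split_ifs with h
  · rw [← h.1, ← h.2, smul_eq_mul]
    ring
  · simp

variable {M : Type*} [AddCommGroup M] [Module ℂ M]

/-- The smallest subspace that contains `w` and is stable under the lowering operators. -/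
def lowerSpan (D : slAlg N →ₗ⁅ℂ⁆ Module.End ℂ M) (w : M) : Submodule ℂ M :=
  sInf {U | w ∈ U ∧ ∀ (i j : Fin N) (hij : j < i), ∀ y ∈ U,
    D (LieAlgebra.SpecialLinear.single i j hij.ne' (1 : ℂ)) y ∈ U}

variable {D : slAlg N →ₗ⁅ℂ⁆ Module.End ℂ M} {w : M}

theorem mem_lowerSpan_self : w ∈ lowerSpan D w :=
  Submodule.mem_sInf.2 fun _ hU => hU.1

theorem lowerSpan_le {U : Submodule ℂ M} (hw : w ∈ U)
    (hU : ∀ (i j : Fin N) (hij : j < i), ∀ y ∈ U,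
      D (LieAlgebra.SpecialLinear.single i j hij.ne' (1 : ℂ)) y ∈ U) : lowerSpan D w ≤ U :=
  sInf_le ⟨hw, hU⟩

theorem lower_mem_lowerSpan {i j : Fin N} (hij : j < i) {y : M} (hy : y ∈ lowerSpan D w) :
    D (LieAlgebra.SpecialLinear.single i j hij.ne' (1 : ℂ)) y ∈ lowerSpan D w :=
  Submodule.mem_sInf.2 fun U hU => hU.2 i j hij y (Submodule.mem_sInf.1 hy U hU)

theorem lie_apply (D : slAlg N →ₗ⁅ℂ⁆ Module.End ℂ M) (X Y : slAlg N) (y : M) :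
    D X (D Y y) = D Y (D X y) + D ⁅X, Y⁆ y := by
  rw [LieHom.map_lie, LieRing.of_associative_ring_bracket, LinearMap.sub_apply,
    Module.End.mul_apply, Module.End.mul_apply]
  abel

/-- The subspace generated from a highest weight vector by the lowering operators is stable under
the Lie algebra. -/
theorem lowerSpan_stable {wt : Module.Dual ℂ (cartan N)}
    (hw : ∀ H : cartan N, D (H : slAlg N) w = wt H • w)
    (hr : ∀ (i j : Fin N) (hij : i < j),
      D (LieAlgebra.SpecialLinear.single i j hij.ne (1 : ℂ)) w = 0)
    (X : slAlg N) (y : M) (hy : y ∈ lowerSpan D w) : D X y ∈ lowerSpan D w := by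
  -- The part of `lowerSpan` sent into it by every X. It contains `w`, and it is closed under
  -- lowering operators Y since XY = YX + [X, Y]; by minimality it is everything.
  let U : Submodule ℂ M :=
    { carrier := {y | y ∈ lowerSpan D w ∧ ∀ X, D X y ∈ lowerSpan D w}
      add_mem' := fun {a b} ha hb => ⟨add_mem ha.1 hb.1, fun X => by
        rw [map_add]; exact add_mem (ha.2 X) (hb.2 X)⟩
      zero_mem' := ⟨zero_mem _, fun X => by rw [map_zero]; exact zero_mem _⟩
      smul_mem' := fun c a ha => ⟨Submodule.smul_mem _ c ha.1, fun X => by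
        rw [map_smul]; exact Submodule.smul_mem _ c (ha.2 X)⟩ }
  suffices h : lowerSpan D w ≤ U from (h hy).2 X
  refine lowerSpan_le ⟨mem_lowerSpan_self, fun X => ?_⟩ ?_
  · let S : Submodule ℂ (slAlg N) :=
      (lowerSpan D w).comap ((LinearMap.applyₗ w).comp (D : slAlg N →ₗ[ℂ] Module.End ℂ M))
    change X ∈ S
    refine slAlg_eq_top (fun H => ?_) (fun i j hij => ?_) X
    · change D (H : slAlg N) w ∈ lowerSpan D w
      rw [hw]
      exact Submodule.smul_mem _ _ mem_lowerSpan_self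
    · change D (LieAlgebra.SpecialLinear.single i j hij (1 : ℂ)) w ∈ lowerSpan D w
      rcases lt_or_gt_of_ne hij with h | h
      · rw [hr i j h]
        exact zero_mem _
      · exact lower_mem_lowerSpan h mem_lowerSpan_self
  · intro i j hij y hy
    refine ⟨lower_mem_lowerSpan hij hy.1, fun X => ?_⟩
    rw [lie_apply]
    exact add_mem (lower_mem_lowerSpan hij (hy.2 X)) (hy.2 _)

/-- A vector of the highest weight in the subspace generated from `w` by the lowering operators is
a multiple of `w`. -/
theorem mem_span_of_mem_lowerSpan {c : ℂ}
    (hw : D (gradingElement N : slAlg N) w = c • w) {y : M}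
    (hy : D (gradingElement N : slAlg N) y = c • y) (hyU : y ∈ lowerSpan D w) :
    ∃ a : ℂ, y = a • w := by
  let H := D (gradingElement N : slAlg N)
  -- Every lowering operator shifts eigenvalues by a negative integer, so it maps ℂw and L into L;
  -- eigenspaces being independent, L does not meet the c-eigenspace.
  let L : Submodule ℂ M := ⨆ n : ℕ, H.eigenspace (c - (n + 1))
  have hlow : ∀ (i j : Fin N) (hij : j < i) (μ : ℂ), ∀ y ∈ H.eigenspace μ,
      D (LieAlgebra.SpecialLinear.single i j hij.ne' (1 : ℂ)) y ∈
        H.eigenspace (μ + (2 * (j : ℕ) - 2 * (i : ℕ))) := by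
    intro i j hij μ y hy
    rw [Module.End.mem_eigenspace_iff] at hy ⊢
    change D _ y = _ at hy
    change D _ _ = _
    rw [lie_apply, gradingElement_lie, hy, map_smul, map_smul, LinearMap.smul_apply, add_smul]
  have hlt : ∀ (i j : Fin N), j < i → ∃ n : ℕ, (2 * (j : ℕ) - 2 * (i : ℕ) : ℂ) = -(n + 1) := by
    intro i j hij
    obtain ⟨k, hk⟩ := Nat.exists_eq_add_of_lt (show (j : ℕ) < i from hij)
    refine ⟨2 * k + 1, ?_⟩
    rw [hk]
    push_cast
    ring
  have hle : lowerSpan D w ≤ (ℂ ∙ w) ⊔ L := by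
    refine lowerSpan_le (Submodule.mem_sup_left (Submodule.mem_span_singleton_self w)) ?_
    intro i j hij y hy
    obtain ⟨n, hn⟩ := hlt i j hij
    refine Submodule.mem_sup_right ?_
    obtain ⟨y₁, hy₁, y₂, hy₂, rfl⟩ := Submodule.mem_sup.1 hy
    rw [map_add]
    refine add_mem ?_ ?_
    · obtain ⟨a, rfl⟩ := Submodule.mem_span_singleton.1 hy₁
      rw [map_smul]
      refine Submodule.smul_mem _ _ (Submodule.mem_iSup_of_mem n ?_)
      have := hlow i j hij c w (Module.End.mem_eigenspace_iff.2 hw)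
      rwa [hn, ← sub_eq_add_neg] at this
    · refine Submodule.iSup_induction _
        (motive := fun y => D (LieAlgebra.SpecialLinear.single i j hij.ne' (1 : ℂ)) y ∈ L)
        hy₂ ?_ ?_ ?_
      · intro m y hy
        refine Submodule.mem_iSup_of_mem (m + n + 1) ?_
        have := hlow i j hij _ y hy
        rw [hn] at this
        convert this using 2
        push_cast
        ring
      · rw [map_zero]; exact zero_mem _
      · intro a b ha hb
        rw [map_add]; exact add_mem ha hb
  have hdisj : Disjoint (H.eigenspace c) L := by
    refine (Module.End.eigenspaces_iSupIndep H c).mono_right (iSup_le fun n => ?_)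
    refine le_iSup₂_of_le (c - (n + 1)) ?_ le_rfl
    intro h
    have h1 : ((n : ℂ) + 1) = 0 := by linear_combination -h
    exact Nat.cast_add_one_ne_zero n h1
  obtain ⟨y₁, hy₁, y₂, hy₂, rfl⟩ := Submodule.mem_sup.1 (hle hyU)
  obtain ⟨a, rfl⟩ := Submodule.mem_span_singleton.1 hy₁
  have h1 : y₂ ∈ H.eigenspace c := by
    have := sub_mem (Module.End.mem_eigenspace_iff.2 hy)
      ((H.eigenspace c).smul_mem a (Module.End.mem_eigenspace_iff.2 hw))
    simpa using this
  exact ⟨a, by rw [Submodule.disjoint_def.1 hdisj _ h1 hy₂, add_zero]⟩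

end Unique

/-! ### Uniqueness of the irreducible representation with a given highest weight -/

section UniqueRep

variable {N : ℕ} {V W : Type*} [AddCommGroup V] [Module ℂ V] [AddCommGroup W] [Module ℂ W]

theorem eq_top_of_isIrreducible {G : Type*} [Group G]
    {ρ : Representation ℂ G V} (h : ρ.IsIrreducible) (U : Submodule ℂ V)
    (hU : ∀ g, ∀ v ∈ U, ρ g v ∈ U) {v : V} (hv : v ≠ 0) (hvU : v ∈ U) : U = ⊤ := by
  rcases h.eq_bot_or_eq_top ⟨U, fun g v hv => hU g v hv⟩ with h1 | h1
  · have h2 : U = ⊥ := congrArg Subrepresentation.toSubmodule h1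
    rw [h2] at hvU
    exact absurd ((Submodule.mem_bot ℂ).1 hvU) hv
  · exact congrArg Subrepresentation.toSubmodule h1

/-- Irreducible representations with the same highest weight are equivalent. -/
theorem IsHighestWeightRep.equiv (hN : 2 ≤ N) {ρ : Representation ℂ (SL N) V}
    {σ : Representation ℂ (SL N) W} {wt : Module.Dual ℂ (cartan N)}
    (hρ : IsHighestWeightRep ρ wt) (hσ : IsHighestWeightRep σ wt) : Nonempty (ρ.Equiv σ) := by
  obtain ⟨D, hD, v, hv, hvw, hvr⟩ := hρ.exists_highest
  obtain ⟨E, hE, w, hw, hww, hwr⟩ := hσ.exists_highest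
  let F : slAlg N →ₗ⁅ℂ⁆ Module.End ℂ (V × W) :=
    { toFun := fun X => (D X).prodMap (E X)
      map_add' := fun X Y => by ext <;> simp
      map_smul' := fun c X => by ext <;> simp
      map_lie' := fun {X Y} => by
        ext <;> simp [LieRing.of_associative_ring_bracket] }
  have hFapp : ∀ X a b, F X (a, b) = (D X a, E X b) := fun _ _ _ => rfl
  -- U will be the graph of the equivalence: both projections are onto by irreducibility, and the
  -- next steps show that both are injective.
  let U := lowerSpan F (v, w)
  have hwF : ∀ H : cartan N, F (H : slAlg N) (v, w) = wt H • (v, w) := fun H => by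
    rw [hFapp, hvw, hww, Prod.smul_mk]
  have hUF : ∀ X, ∀ y ∈ U, F X y ∈ U := fun X y hy =>
    lowerSpan_stable hwF (fun i j hij => by rw [hFapp, hvr i j hij, hwr i j hij]; rfl) X y hy
  have hUG : ∀ g, ∀ y ∈ U, (ρ.prod σ) g y ∈ U := fun g =>
    stable_of_hasDiff hN (fun X γ hγ => HasDiff.prod (hD X γ hγ) (hE X γ hγ)) U hUF g
  have hc := hwF (gradingElement N)
  have hUw : (v, w) ∈ U := mem_lowerSpan_self
  have hfst : U.map (LinearMap.fst ℂ V W) = ⊤ := by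
    refine eq_top_of_isIrreducible hρ.irreducible _ ?_ hv ⟨(v, w), hUw, rfl⟩
    rintro g _ ⟨y, hy, rfl⟩
    exact ⟨_, hUG g y hy, rfl⟩
  have hsnd : U.map (LinearMap.snd ℂ V W) = ⊤ := by
    refine eq_top_of_isIrreducible hσ.irreducible _ ?_ hw ⟨(v, w), hUw, rfl⟩
    rintro g _ ⟨y, hy, rfl⟩
    exact ⟨_, hUG g y hy, rfl⟩
  have hker1 : ∀ b, ((0 : V), b) ∈ U → b = 0 := by
    intro b hb
    by_contra hb0
    have htop : U.comap (LinearMap.inr ℂ V W) = ⊤ := by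
      refine eq_top_of_isIrreducible hσ.irreducible _ ?_ hb0 hb
      intro g y hy
      have := hUG g _ hy
      change (ρ g 0, σ g y) ∈ U at this
      rwa [map_zero] at this
    -- If U met 0 × W nontrivially it would contain all of it, hence `(0, w)`. That vector has the
    -- highest weight without being a multiple of `(v, w)`.
    have h1 : ((0 : V), w) ∈ U := by
      have : w ∈ U.comap (LinearMap.inr ℂ V W) := htop ▸ Submodule.mem_top
      exact this
    obtain ⟨a, ha⟩ := mem_span_of_mem_lowerSpan hc
      (by rw [hFapp, map_zero, hww, Prod.smul_mk, smul_zero]) h1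
    rw [Prod.smul_mk, Prod.mk.injEq] at ha
    have ha0 : a = 0 := (smul_eq_zero.1 ha.1.symm).resolve_right hv
    exact hw (by rw [ha.2, ha0, zero_smul])
  have hker2 : ∀ a, (a, (0 : W)) ∈ U → a = 0 := by
    intro b hb
    by_contra hb0
    have htop : U.comap (LinearMap.inl ℂ V W) = ⊤ := by
      refine eq_top_of_isIrreducible hρ.irreducible _ ?_ hb0 hb
      intro g y hy
      have := hUG g _ hy
      change (ρ g y, σ g 0) ∈ U at this
      rwa [map_zero] at this
    have h1 : (v, (0 : W)) ∈ U := by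
      have : v ∈ U.comap (LinearMap.inl ℂ V W) := htop ▸ Submodule.mem_top
      exact this
    obtain ⟨a, ha⟩ := mem_span_of_mem_lowerSpan hc
      (by rw [hFapp, map_zero, hvw, Prod.smul_mk, smul_zero]) h1
    rw [Prod.smul_mk, Prod.mk.injEq] at ha
    have ha0 : a = 0 := (smul_eq_zero.1 ha.2.symm).resolve_right hw
    exact hv (by rw [ha.1, ha0, zero_smul])
  let e₁ : U ≃ₗ[ℂ] V := LinearEquiv.ofBijective ((LinearMap.fst ℂ V W).domRestrict U) (by
    constructor
    · rw [injective_iff_map_eq_zero]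
      rintro ⟨⟨a, b⟩, hab⟩ (h : a = 0)
      subst h
      have := hker1 b hab
      subst this
      rfl
    · intro a
      obtain ⟨y, hy, rfl⟩ : a ∈ U.map (LinearMap.fst ℂ V W) := hfst ▸ Submodule.mem_top
      exact ⟨⟨y, hy⟩, rfl⟩)
  let e₂ : U ≃ₗ[ℂ] W := LinearEquiv.ofBijective ((LinearMap.snd ℂ V W).domRestrict U) (by
    constructor
    · rw [injective_iff_map_eq_zero]
      rintro ⟨⟨a, b⟩, hab⟩ (h : b = 0)
      subst h
      have := hker2 a hab
      subst this
      rfl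
    · intro a
      obtain ⟨y, hy, rfl⟩ : a ∈ U.map (LinearMap.snd ℂ V W) := hsnd ▸ Submodule.mem_top
      exact ⟨⟨y, hy⟩, rfl⟩)
  refine ⟨Representation.Equiv.mk (e₁.symm.trans e₂) fun g => ?_⟩
  ext a
  obtain ⟨y, rfl⟩ := e₁.surjective a
  have h1 : ρ g (e₁ y) = e₁ ⟨_, hUG g y.1 y.2⟩ := rfl
  simp only [LinearMap.comp_apply, LinearEquiv.coe_coe, LinearEquiv.trans_apply]
  rw [h1, LinearEquiv.symm_apply_apply, LinearEquiv.symm_apply_apply]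
  rfl

end UniqueRep

/-! ### The infinitesimal action on polynomials -/

section LinDer

variable {N : ℕ}

/-- The derivation `∑ X_ij x_i ∂_j` of the polynomial ring. -/
def linDer (X : Matrix (Fin N) (Fin N) ℂ) :
    Derivation ℂ (MvPolynomial (Fin N) ℂ) (MvPolynomial (Fin N) ℂ) :=
  mkDerivation ℂ fun j => ∑ i, X i j • (MvPolynomial.X i : MvPolynomial (Fin N) ℂ)

theorem linDer_X (A : Matrix (Fin N) (Fin N) ℂ) (j : Fin N) :
    linDer A (X j) = ∑ i, A i j • (X i : MvPolynomial (Fin N) ℂ) :=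
  mkDerivation_X _ _ _

theorem linDer_add (A B : Matrix (Fin N) (Fin N) ℂ) : linDer (A + B) = linDer A + linDer B := by
  apply MvPolynomial.derivation_ext
  intro j
  simp [linDer_X, add_smul, Finset.sum_add_distrib]

theorem linDer_smul (c : ℂ) (A : Matrix (Fin N) (Fin N) ℂ) :
    linDer (c • A) = c • linDer A := by
  apply MvPolynomial.derivation_ext
  intro j
  simp [linDer_X, mul_smul, Finset.smul_sum]

theorem linDer_lie (A B : Matrix (Fin N) (Fin N) ℂ) :
    linDer (A * B - B * A) = ⁅linDer A, linDer B⁆ := by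
  apply MvPolynomial.derivation_ext
  intro j
  have h : ∀ A B : Matrix (Fin N) (Fin N) ℂ, linDer A (linDer B (X j)) =
      ∑ i, (A * B) i j • (X i : MvPolynomial (Fin N) ℂ) := by
    intro A B
    simp only [linDer_X, map_sum, Derivation.map_smul, Finset.smul_sum, Matrix.mul_apply,
      Finset.sum_smul, smul_smul]
    rw [Finset.sum_comm]
    simp only [mul_comm]
  rw [Derivation.commutator_apply, h, h, linDer_X, ← Finset.sum_sub_distrib]
  simp only [Matrix.sub_apply, sub_smul]

theorem linDer_single (i j : Fin N) (p : MvPolynomial (Fin N) ℂ) :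
    linDer (Matrix.single i j 1) p = X i * pderiv j p := by
  have h : linDer (Matrix.single i j 1) = (X i : MvPolynomial (Fin N) ℂ) • pderiv j := by
    apply MvPolynomial.derivation_ext
    intro a
    rw [linDer_X, Finset.sum_eq_single i]
    · by_cases h : j = a
      · subst h; simp
      · simp [h, pderiv_X]
    · intro b _ hb
      simp [hb.symm]
    · simp
  rw [h]
  rfl

theorem derivation_sum_apply {ι : Type*} (s : Finset ι)
    (f : ι → Derivation ℂ (MvPolynomial (Fin N) ℂ) (MvPolynomial (Fin N) ℂ))
    (p : MvPolynomial (Fin N) ℂ) : (∑ i ∈ s, f i) p = ∑ i ∈ s, f i p := by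
  rw [← Finset.sum_apply]
  exact congrFun (map_sum Derivation.coeFnAddMonoidHom f s) p

theorem linDer_diagonal_monomial (v : Fin N → ℂ) (a : Fin N →₀ ℕ) (c : ℂ) :
    linDer (Matrix.diagonal v) (monomial a c) = (∑ i, v i * a i) • monomial a c := by
  have h : linDer (Matrix.diagonal v) =
      ∑ i, v i • (X i : MvPolynomial (Fin N) ℂ) • pderiv i := by
    apply MvPolynomial.derivation_ext
    intro b
    rw [linDer_X, derivation_sum_apply]
    simp only [Derivation.smul_apply, pderiv_X, Matrix.diagonal_apply, Pi.single_apply]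
    refine Finset.sum_congr rfl fun i _ => ?_
    by_cases hi : i = b
    · subst hi; simp
    · simp [hi, Ne.symm hi]
  rw [h, derivation_sum_apply, Finset.sum_smul]
  refine Finset.sum_congr rfl fun i _ => ?_
  rw [Derivation.smul_apply, Derivation.smul_apply, smul_eq_mul, X_mul_pderiv_monomial,
    mul_smul, Nat.cast_smul_eq_nsmul]

theorem linDer_mem {k : ℕ} (A : Matrix (Fin N) (Fin N) ℂ) :
    ∀ p ∈ SymPow N k, (linDer A : Module.End ℂ (MvPolynomial (Fin N) ℂ)) p ∈ SymPow N k := by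
  intro p hp
  have h : linDer A = ∑ i, ∑ j, A i j • linDer (Matrix.single i j 1) := by
    conv_lhs => rw [Matrix.matrix_eq_sum_single A]
    let L : Matrix (Fin N) (Fin N) ℂ →ₗ[ℂ]
        Derivation ℂ (MvPolynomial (Fin N) ℂ) (MvPolynomial (Fin N) ℂ) :=
      { toFun := linDer, map_add' := linDer_add, map_smul' := linDer_smul }
    change L _ = ∑ i, ∑ j, A i j • L _
    simp only [map_sum, ← map_smul, Matrix.smul_single, smul_eq_mul, mul_one]
  change linDer A p ∈ _
  rw [h]
  simp only [derivation_sum_apply, Derivation.smul_apply, linDer_single]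
  refine Submodule.sum_mem _ fun i _ => Submodule.sum_mem _ fun j _ => Submodule.smul_mem _ _ ?_
  have hp' := (mem_homogeneousSubmodule _ _).1 hp
  -- Degree 0 is separate: there the degree bound for `X i * pderiv j p` would be 0 - 1 + 1 = 1 with
  -- truncated subtraction, but the derivative of a constant is zero.
  rcases k with _ | k
  · rw [SymPow, homogeneousSubmodule_zero] at hp
    obtain ⟨c, rfl⟩ := Submodule.mem_one.1 hp
    simp [algebraMap_eq]
  · rw [mem_homogeneousSubmodule]
    simpa [add_comm] using (isHomogeneous_X ℂ i).mul hp'.pderiv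

/-- The differential of `symRep`. -/
def symDer (N k : ℕ) (A : Matrix (Fin N) (Fin N) ℂ) : Module.End ℂ (SymPow N k) :=
  (linDer A : Module.End ℂ (MvPolynomial (Fin N) ℂ)).restrict (linDer_mem A)

theorem symDer_coe {k : ℕ} (A : Matrix (Fin N) (Fin N) ℂ) (p : SymPow N k) :
    (symDer N k A p : MvPolynomial (Fin N) ℂ) = linDer A p := rfl

/-- The differential of `symRep` as a homomorphism of Lie algebras. -/
def symDerHom (N k : ℕ) : slAlg N →ₗ⁅ℂ⁆ Module.End ℂ (SymPow N k) where
  toFun X := symDer N k X.1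
  map_add' X Y := by
    ext p : 2
    simp [symDer_coe, linDer_add]
  map_smul' c X := by
    ext p : 2
    simp [symDer_coe, linDer_smul]
  map_lie' := by
    intro A B
    ext p : 2
    rw [symDer_coe, LieAlgebra.SpecialLinear.sl_bracket, linDer_lie, Derivation.commutator_apply]
    simp [LieRing.of_associative_ring_bracket, symDer_coe]

/-- Differentiating an algebra homomorphism at the identity gives a derivation, so it suffices to
check variables and apply the product rule coefficientwise. -/
theorem hasDerivAt_coeff_subst {A : ℂ → Matrix (Fin N) (Fin N) ℂ}
    {B : Matrix (Fin N) (Fin N) ℂ} (h0 : A 0 = 1)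
    (h : ∀ i j, HasDerivAt (fun t => A t i j) (B i j) 0) (p : MvPolynomial (Fin N) ℂ)
    (d : Fin N →₀ ℕ) :
    HasDerivAt (fun t => coeff d (subst (A t) p)) (coeff d (linDer B p)) 0 := by
  induction p using MvPolynomial.induction_on generalizing d with
  | C a =>
    simp only [subst, algHom_C, algebraMap_eq, derivation_C, coeff_zero]
    exact hasDerivAt_const _ _
  | add p q hp hq =>
    simp only [map_add, coeff_add]
    exact (hp d).add (hq d)
  | mul_X p j hp =>
    have hX : ∀ d, HasDerivAt (fun t => coeff d (subst (A t) (X j))) (coeff d (linDer B (X j))) 0 := by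
      intro d
      simp only [subst, aeval_X, linDer_X, coeff_sum, coeff_smul, smul_eq_mul]
      exact HasDerivAt.fun_sum fun i _ => (h i j).mul_const _
    have hs : subst (A 0) = AlgHom.id ℂ (MvPolynomial (Fin N) ℂ) := by rw [h0, subst_one]
    simp only [map_mul, coeff_mul, Derivation.leibniz, smul_eq_mul, coeff_add]
    have := HasDerivAt.fun_sum (u := Finset.HasAntidiagonal.antidiagonal d) fun x _ => (hp x.1).mul (hX x.2)
    refine this.congr_deriv ?_
    simp only [hs, AlgHom.id_apply, Finset.sum_add_distrib]
    rw [add_comm]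
    congr 1
    rw [← coeff_mul, ← coeff_mul, mul_comm]

theorem finite_degree_eq (N k : ℕ) : {d : Fin N →₀ ℕ | d.degree = k}.Finite := by
  refine (Finsupp.finite_of_degree_le k).subset fun d hd => le_of_eq hd

/-- The monomial `x^a` as an element of `S^k`, for `|a| = k`. -/
def symMonomial {k : ℕ} (a : Fin N →₀ ℕ) (ha : a.degree = k) : SymPow N k :=
  ⟨monomial a 1, (mem_homogeneousSubmodule _ _).2 (isHomogeneous_monomial _ ha)⟩

theorem degree_eq_of_mem_support {k : ℕ} {p : MvPolynomial (Fin N) ℂ} (hp : p ∈ SymPow N k)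
    {a : Fin N →₀ ℕ} (ha : a ∈ p.support) : a.degree = k := by
  rw [← (mem_homogeneousSubmodule _ _).1 hp (mem_support_iff.1 ha)]
  exact DFunLike.congr_fun (Finsupp.degree_eq_weight_one (R := ℕ)) a

theorem sum_symMonomial {k : ℕ} (p : SymPow N k) :
    p = ∑ a : {a : Fin N →₀ ℕ // a ∈ (finite_degree_eq N k).toFinset},
      coeff a.1 p.1 • symMonomial a.1 ((finite_degree_eq N k).mem_toFinset.1 a.2) := by
  apply Subtype.ext
  rw [AddSubmonoidClass.coe_finsetSum]
  simp only [Submodule.coe_smul, symMonomial, smul_monomial, smul_eq_mul, mul_one]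
  rw [Finset.sum_coe_sort _ fun a => monomial a (coeff a p.1)]
  conv_lhs => rw [as_sum p.1]
  refine Finset.sum_subset (fun a ha => ?_) fun a _ ha => ?_
  · exact (finite_degree_eq N k).mem_toFinset.2 (degree_eq_of_mem_support p.2 ha)
  · rw [notMem_support_iff.1 ha, monomial_zero]

theorem span_symMonomial {k : ℕ} {U : Submodule ℂ (SymPow N k)}
    (h : ∀ a (ha : a.degree = k), symMonomial a ha ∈ U) : U = ⊤ := by
  rw [eq_top_iff]
  rintro p -
  rw [sum_symMonomial p]
  exact U.sum_mem fun a _ => U.smul_mem _ (h _ _)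

instance (N k : ℕ) : FiniteDimensional ℂ (SymPow N k) := by
  let S : Finset {a : Fin N →₀ ℕ // a ∈ (finite_degree_eq N k).toFinset} := Finset.univ
  refine ⟨⟨S.image fun a => symMonomial a.1 ((finite_degree_eq N k).mem_toFinset.1 a.2), ?_⟩⟩
  refine span_symMonomial fun a ha => Submodule.subset_span ?_
  exact Finset.mem_coe.2 (Finset.mem_image.2
    ⟨⟨a, (finite_degree_eq N k).mem_toFinset.2 ha⟩, Finset.mem_univ _, rfl⟩)

/-- Any functional on S^k is a finite combination of coefficient functionals, so coefficientwise
derivatives are enough. -/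
theorem hasDerivAt_dual_restrict {k : ℕ} {q : ℂ → SymPow N k} {q' : SymPow N k}
    (h : ∀ d, HasDerivAt (fun t => coeff d (q t : MvPolynomial (Fin N) ℂ))
      (coeff d (q' : MvPolynomial (Fin N) ℂ)) 0) (f : Module.Dual ℂ (SymPow N k)) :
    HasDerivAt (fun t => f (q t)) (f q') 0 := by
  have key : ∀ p : SymPow N k, f p = ∑ a : {a : Fin N →₀ ℕ // a ∈ (finite_degree_eq N k).toFinset},
      coeff a.1 p.1 * f (symMonomial a.1 ((finite_degree_eq N k).mem_toFinset.1 a.2)) := by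
    intro p
    conv_lhs => rw [sum_symMonomial p]
    rw [map_sum]
    simp only [map_smul, smul_eq_mul]
  rw [key q', funext fun t => key (q t)]
  exact HasDerivAt.fun_sum fun d _ => (h d).mul_const _

theorem symRep_hasDiff {k : ℕ} {γ : ℂ → SL N} {A : Matrix (Fin N) (Fin N) ℂ}
    (h : IsOneParam γ A) : HasDiff (symRep N k) γ (symDer N k A) := fun v f =>
  hasDerivAt_dual_restrict (q := fun t => symRep N k (γ t) v)
    (q' := symDer N k A v) (fun d =>
    hasDerivAt_coeff_subst (A := fun t => (γ t).1) (by rw [h.zero]; rfl)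
      (fun i j => h.hasDerivAt i j) v.1 d) f

theorem symDualRep_hasDiff {k : ℕ} {γ : ℂ → SL N} {A : Matrix (Fin N) (Fin N) ℂ}
    (h : IsOneParam γ A) : HasDiff (symDualRep N k) γ (symDer N k (-A.transpose)) := fun v f =>
  hasDerivAt_dual_restrict (q := fun t => symDualRep N k (γ t) v)
    (q' := symDer N k (-A.transpose) v) (fun d =>
    hasDerivAt_coeff_subst (A := fun t => ((γ t)⁻¹ : SL N).1.transpose) (by simp [h.zero])
      (fun i j => h.hasDerivAt_inv_transpose i j) v.1 d) f

theorem tensorRep_hasDiff {k l : ℕ} {γ : ℂ → SL N} {A : Matrix (Fin N) (Fin N) ℂ}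
    (h : IsOneParam γ A) : 
    HasDiff (V := SymPow N k ⊗[ℂ] SymPow N l) (tensorRep N k l) γ
      (TensorProduct.map (symDer N k A) LinearMap.id +
        TensorProduct.map LinearMap.id (symDer N l (-A.transpose))) :=
  HasDiff.tprod h.zero (symRep_hasDiff h) (symDualRep_hasDiff h)

end LinDer

/-! ### Irreducibility and highest weight of S^k -/

section Irreducible

variable {N : ℕ}

/-- Writing exponents as `b` plus a unit vector avoids truncated subtraction and makes the scalar
visibly nonzero. -/
theorem symDer_single_symMonomial {k : ℕ} (i j : Fin N) (b : Fin N →₀ ℕ)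
    (hj : (b + Finsupp.single j 1).degree = k) (hi : (b + Finsupp.single i 1).degree = k) :
    symDer N k (Matrix.single i j 1) (symMonomial (b + Finsupp.single j 1) hj) =
      ((b j : ℂ) + 1) • symMonomial (b + Finsupp.single i 1) hi := by
  apply Subtype.ext
  rw [symDer_coe, linDer_single]
  simp only [symMonomial, Submodule.coe_smul]
  rw [pderiv_monomial, X, monomial_mul, smul_monomial]
  simp [add_comm]

theorem symDer_diagonal_symMonomial {k : ℕ} (v : Fin N → ℂ) (a : Fin N →₀ ℕ) (ha : a.degree = k) :
    symDer N k (Matrix.diagonal v) (symMonomial a ha) = (∑ i, v i * a i) • symMonomial a ha := by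
  apply Subtype.ext
  rw [symDer_coe]
  exact linDer_diagonal_monomial v a 1

theorem eq_single_of_degree {k : ℕ} {a : Fin N →₀ ℕ} (ha : a.degree = k) (z : Fin N)
    (hz : k ≤ a z) : a = Finsupp.single z k := by
  rw [Finsupp.degree_eq_sum, ← Finset.add_sum_erase _ _ (Finset.mem_univ z)] at ha
  have h0 : ∑ x ∈ Finset.univ.erase z, a x = 0 := by omega
  ext j
  by_cases hj : j = z
  · subst hj
    rw [Finsupp.single_eq_same]
    omega
  · rw [Finsupp.single_eq_of_ne hj]
    exact (Finset.sum_eq_zero_iff.1 h0) j (Finset.mem_erase.2 ⟨hj, Finset.mem_univ _⟩)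

theorem exists_add_single_of_degree {k : ℕ} {a : Fin N →₀ ℕ} (ha : a.degree = k) (z : Fin N)
    (hz : a z < k) : ∃ (j : Fin N) (b : Fin N →₀ ℕ), j ≠ z ∧ a = b + Finsupp.single j 1 := by
  obtain ⟨j, hj, hja⟩ : ∃ j, j ≠ z ∧ a j ≠ 0 := by
    by_contra! h
    rw [Finsupp.degree_eq_sum, Finset.sum_eq_single z (fun j _ hj => h j hj) (by simp)] at ha
    omega
  refine ⟨j, a - Finsupp.single j 1, hj, (tsub_add_cancel_of_le ?_).symm⟩
  exact Finsupp.single_le_iff.2 (Nat.one_le_iff_ne_zero.2 hja)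

variable {k : ℕ} {U : Submodule ℂ (SymPow N k)}

/-- Starting from x_z^k, the operators x_j ∂_z reach every monomial up to nonzero scalars; the
induction is on a bound for the deficit k - a_z. -/
theorem eq_top_of_symMonomial_single_mem
    (hU : ∀ i j : Fin N, i ≠ j → ∀ p ∈ U, symDer N k (Matrix.single i j 1) p ∈ U) (z : Fin N)
    (hz : symMonomial (Finsupp.single z k) (Finsupp.degree_single _ _) ∈ U) : U = ⊤ := by
  suffices h : ∀ n a (ha : a.degree = k), k ≤ a z + n → symMonomial a ha ∈ U from
    span_symMonomial fun a ha => h k a ha (by omega)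
  intro n
  induction n with
  | zero =>
    intro a ha hn
    obtain rfl := eq_single_of_degree ha z hn
    exact hz
  | succ n ih =>
    intro a ha hn
    by_cases hak : k ≤ a z
    · exact ih a ha (by omega)
    · obtain ⟨j, b, hj, rfl⟩ := exists_add_single_of_degree ha z (by omega)
      have hb : (b + Finsupp.single z 1).degree = k := by
        rw [← ha, map_add, map_add, Finsupp.degree_single, Finsupp.degree_single]
      have h1 := hU j z hj _ (ih (b + Finsupp.single z 1) hb (by
        simp [hj.symm] at hn ⊢
        omega))
      rw [symDer_single_symMonomial j z b hb ha] at h1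
      exact (U.smul_mem_iff (Nat.cast_add_one_ne_zero (b z))).1 h1

/-- Operators x_z ∂_j push a nonzero polynomial towards x_z^k. Choosing j from a monomial of maximal
deficit k - a_z keeps the image nonzero while lowering the deficit bound by one. -/
theorem symMonomial_single_mem
    (hU : ∀ i j : Fin N, i ≠ j → ∀ p ∈ U, symDer N k (Matrix.single i j 1) p ∈ U) (z : Fin N)
    {p : SymPow N k} (hp0 : p ≠ 0) (hp : p ∈ U) :
    symMonomial (Finsupp.single z k) (Finsupp.degree_single _ _) ∈ U := by
  suffices h : ∀ n, ∀ p ∈ U, p ≠ 0 → (∀ a ∈ p.1.support, k ≤ a z + n) →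
      symMonomial (Finsupp.single z k) (Finsupp.degree_single _ _) ∈ U from
    h k p hp hp0 fun a _ => by omega
  clear hp hp0 p
  intro n
  induction n with
  | zero =>
    intro p hp hp0 hs
    have hs' : ∀ a ∈ p.1.support, a = Finsupp.single z k := fun a ha =>
      eq_single_of_degree (degree_eq_of_mem_support p.2 ha) z (hs a ha)
    have h1 : p = coeff (Finsupp.single z k) p.1 •
        symMonomial (Finsupp.single z k) (Finsupp.degree_single _ _) := by
      apply Subtype.ext
      ext d
      simp only [Submodule.coe_smul, symMonomial, coeff_smul, coeff_monomial, smul_eq_mul]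
      split_ifs with hd
      · rw [hd, mul_one]
      · rw [mul_zero]
        by_contra hc
        exact hd (hs' d (mem_support_iff.2 hc)).symm
    have h2 : coeff (Finsupp.single z k) p.1 ≠ 0 := fun h => hp0 (by rw [h1, h, zero_smul])
    rw [h1] at hp
    exact (U.smul_mem_iff h2).1 hp
  | succ n ih =>
    intro p hp hp0 hs
    by_cases hall : ∀ a ∈ p.1.support, k ≤ a z + n
    · exact ih p hp hp0 hall
    push Not at hall
    obtain ⟨a, ha, haz⟩ := hall
    obtain ⟨j, b, hj, rfl⟩ :=
      exists_add_single_of_degree (degree_eq_of_mem_support p.2 ha) z (by omega)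
    refine ih _ (hU z j hj.symm p hp) ?_ ?_
    · intro h0
      -- The coefficient of x_z x^b in x_z ∂_j p is (b_j + 1) times that of x^b x_j in p, so no
      -- cancellation can occur.
      have h1 := congrArg (fun q : SymPow N k => coeff (Finsupp.single z 1 + b) q.1) h0
      simp only [symDer_coe, linDer_single, coeff_X_mul, coeff_pderiv] at h1
      have h2 : coeff (b + Finsupp.single j 1) p.1 * ((b j : ℂ) + 1) = 0 := by simpa using h1
      exact (mul_ne_zero (mem_support_iff.1 ha) (Nat.cast_add_one_ne_zero _)) h2
    · intro d hd
      rw [mem_support_iff, symDer_coe, linDer_single, coeff_X_mul'] at hd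
      split_ifs at hd with hz
      · obtain ⟨c, rfl⟩ : ∃ c, d = c + Finsupp.single z 1 :=
          ⟨d - Finsupp.single z 1, (tsub_add_cancel_of_le (Finsupp.single_le_iff.2
            (Nat.one_le_iff_ne_zero.2 (Finsupp.mem_support_iff.1 hz)))).symm⟩
        rw [add_tsub_cancel_right, coeff_pderiv] at hd
        have := hs _ (mem_support_iff.2 (left_ne_zero_of_mul hd))
        simp [hj.symm] at this ⊢
        omega
      · exact absurd rfl hd

theorem symMonomial_ne_zero (a : Fin N →₀ ℕ) (ha : a.degree = k) : symMonomial a ha ≠ 0 := by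
  intro h
  have := congrArg (fun q : SymPow N k => coeff a q.1) h
  simp [symMonomial] at this

theorem symRep_isIrreducible (hN : 2 ≤ N) (k : ℕ) : (symRep N k).IsIrreducible := by
  let z : Fin N := ⟨0, by omega⟩
  have hz := symMonomial_ne_zero (Finsupp.single z k) (Finsupp.degree_single _ _)
  refine { exists_pair_ne := ⟨⊥, ⊤, fun h => ?_⟩, eq_bot_or_eq_top := fun S => ?_ }
  · have h1 : (⊥ : Submodule ℂ (SymPow N k)) = ⊤ := congrArg Subrepresentation.toSubmodule h
    exact hz ((Submodule.mem_bot ℂ).1 (h1 ▸ Submodule.mem_top))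
  · have hU : ∀ i j : Fin N, i ≠ j → ∀ p ∈ S.toSubmodule,
        symDer N k (Matrix.single i j 1) p ∈ S.toSubmodule := by
      intro i j hij p hp
      obtain ⟨γ, hγ⟩ := exists_oneParam_single hij 1
      exact (symRep_hasDiff hγ).mem _ (fun g v hv => S.apply_mem_toSubmodule g hv) hp
    by_cases hS : S.toSubmodule = ⊥
    · exact Or.inl (Subrepresentation.toSubmodule_injective hS)
    · obtain ⟨p, hp, hp0⟩ := (Submodule.ne_bot_iff _).1 hS
      exact Or.inr (Subrepresentation.toSubmodule_injective
        (eq_top_of_symMonomial_single_mem hU z (symMonomial_single_mem hU z hp0 hp)))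

theorem symRep_isHighestWeightRep (hN : 2 ≤ N) (k : ℕ) :
    IsHighestWeightRep (symRep N k) (k • fundamentalWeight N 1) where
  finiteDimensional := inferInstance
  irreducible := symRep_isIrreducible hN k
  exists_highest := by
    let z : Fin N := ⟨0, by omega⟩
    refine ⟨symDerHom N k, fun X γ hγ => symRep_hasDiff hγ,
      symMonomial (Finsupp.single z k) (Finsupp.degree_single _ _), symMonomial_ne_zero _ _,
      fun H => ?_, fun i j hij => ?_⟩
    · have hd : H.1.1 = Matrix.diagonal fun i => H.1.1 i i := by
        ext i j
        by_cases h : i = j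
        · subst h; simp
        · rw [H.2 i j h, Matrix.diagonal_apply_ne _ h]
      have hw : fundamentalWeight N 1 = epsilon N z := by
        have : Finset.univ.filter (fun j : Fin N => (j : ℕ) < 1) = {z} := by
          ext j
          simp [z, Fin.ext_iff]
        rw [fundamentalWeight, this, Finset.sum_singleton]
      change symDer N k H.1.1 _ = _
      rw [hd, symDer_diagonal_symMonomial, hw, Finset.sum_eq_single z]
      · rw [Finsupp.single_eq_same, LinearMap.smul_apply, nsmul_eq_mul, mul_comm]
        rfl
      · intro j _ hj
        simp [Finsupp.single_eq_of_ne hj]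
      · simp
    · have hj : j ≠ z := fun h => by
        subst h
        exact absurd (Fin.lt_def.1 hij) (by simp [z])
      change symDer N k (Matrix.single i j 1) _ = 0
      apply Subtype.ext
      rw [symDer_coe, linDer_single]
      simp [symMonomial, pderiv_monomial, Finsupp.single_eq_of_ne hj]

end Irreducible

/-! ### Constant coefficient operators and equivariance of div -/

section DiffOp

variable {N : ℕ}

theorem pderiv_comm (i j : Fin N) (p : MvPolynomial (Fin N) ℂ) :
    pderiv i (pderiv j p) = pderiv j (pderiv i p) := by
  ext d
  simp only [coeff_pderiv, Finsupp.add_apply]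
  by_cases h : i = j
  · subst h; rfl
  · simp only [Finsupp.single_eq_of_ne h, Finsupp.single_eq_of_ne (Ne.symm h), add_zero,
      add_right_comm d (Finsupp.single i 1)]
    ring

/-- The partial derivative `∂_i` as a linear map. -/
abbrev pd (i : Fin N) : Module.End ℂ (MvPolynomial (Fin N) ℂ) :=
  ((pderiv i : Derivation ℂ (MvPolynomial (Fin N) ℂ) (MvPolynomial (Fin N) ℂ)) :
    Module.End ℂ (MvPolynomial (Fin N) ℂ))

theorem pd_commute (i j : Fin N) : Commute (pd i) (pd j) :=
  LinearMap.ext fun p => pderiv_comm i j p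

theorem partialMonomial_commute (i : Fin N) (m : Fin N →₀ ℕ) :
    Commute (pd i) (partialMonomial m) := by
  refine Commute.list_prod_right _ _ fun x hx => ?_
  obtain ⟨j, -, rfl⟩ := List.mem_map.1 hx
  exact (pd_commute i j).pow_right _

theorem partialMonomial_single_add (i : Fin N) (m : Fin N →₀ ℕ) :
    partialMonomial (Finsupp.single i 1 + m) = pd i * partialMonomial m := by
  have h : ∀ L : List (Fin N), L.Nodup →
      (L.map fun j => pd j ^ (Finsupp.single i 1 + m : Fin N →₀ ℕ) j).prod =
        (if i ∈ L then pd i else 1) * (L.map fun j => pd j ^ m j).prod := by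
    intro L
    induction L with
    | nil => simp
    | cons a L ih =>
      intro hL
      rw [List.nodup_cons] at hL
      rw [List.map_cons, List.prod_cons, ih hL.2, List.map_cons, List.prod_cons]
      by_cases ha : i = a
      · subst ha
        simp [hL.1, pow_add, mul_assoc]
      · have h1 : (Finsupp.single i 1 + m : Fin N →₀ ℕ) a = m a := by
          simp [Finsupp.single_eq_of_ne (Ne.symm ha)]
        rw [h1]
        by_cases hi : i ∈ L
        · simp only [hi, if_true, List.mem_cons, or_true, ← mul_assoc]
          rw [((pd_commute i a).pow_right (m a)).eq]
        · simp [hi, ha]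
  have h1 := h _ (List.nodup_finRange N)
  rwa [if_pos (List.mem_finRange i)] at h1

theorem diffOp_monomial (m : Fin N →₀ ℕ) : diffOp (monomial m (1 : ℂ)) = partialMonomial m := by
  have h := (basisMonomials (Fin N) ℂ).constr_basis ℂ (partialMonomial (N := N)) m
  rwa [coe_basisMonomials] at h

theorem diffOp_one : diffOp (1 : MvPolynomial (Fin N) ℂ) = 1 := by
  change diffOp (monomial 0 1) = 1
  rw [diffOp_monomial]
  simp [partialMonomial]

theorem diffOp_ext {E : Type*} [AddCommMonoid E] [Module ℂ E]
    {f g : MvPolynomial (Fin N) ℂ →ₗ[ℂ] E} (h : ∀ m, f (monomial m 1) = g (monomial m 1)) :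
    f = g :=
  (basisMonomials (Fin N) ℂ).ext fun m => by simpa using h m

/-- This is the multiplicativity of Q ↦ Q(∂) needed to induct on Q, the defining basis of monomials
entering only here. -/
theorem diffOp_X_mul (i : Fin N) (q : MvPolynomial (Fin N) ℂ) :
    diffOp (X i * q) = pd i * diffOp q := by
  have h : diffOp.comp (LinearMap.mulLeft ℂ (X i : MvPolynomial (Fin N) ℂ)) =
      (LinearMap.mulLeft ℂ (pd i)).comp diffOp := by
    refine diffOp_ext fun m => ?_
    simp only [LinearMap.comp_apply, LinearMap.mulLeft_apply]
    rw [X, monomial_mul, one_mul, diffOp_monomial, diffOp_monomial, partialMonomial_single_add]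
  exact LinearMap.congr_fun h q

theorem diffOp_commute (i : Fin N) (q : MvPolynomial (Fin N) ℂ) :
    pd i * diffOp q = diffOp q * pd i := by
  have h : (LinearMap.mulLeft ℂ (pd i)).comp diffOp =
      (LinearMap.mulRight ℂ (pd i)).comp (diffOp (N := N)) := by
    refine diffOp_ext fun m => ?_
    simp only [LinearMap.comp_apply, LinearMap.mulLeft_apply, LinearMap.mulRight_apply]
    rw [diffOp_monomial]
    exact (partialMonomial_commute i m).eq
  exact LinearMap.congr_fun h q

/-- The chain rule for a linear substitution. -/
theorem pderiv_subst (A : Matrix (Fin N) (Fin N) ℂ) (i : Fin N) (p : MvPolynomial (Fin N) ℂ) :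
    pderiv i (subst A p) = ∑ a, A i a • subst A (pderiv a p) := by
  induction p using MvPolynomial.induction_on with
  | C a => simp [subst]
  | add p q hp hq => simp only [map_add, hp, hq, smul_add, Finset.sum_add_distrib]
  | mul_X p j hp =>
    have hX : pderiv i (subst A (X j)) = ∑ a, A i a • subst A (pderiv a (X j)) := by
      simp only [subst, aeval_X, map_sum, Derivation.map_smul, pderiv_X]
      rw [Finset.sum_eq_single i, Finset.sum_eq_single j]
      · simp
      · intro b _ hb; simp [hb]
      · simp
      · intro b _ hb; simp [hb]
      · simp
    simp only [map_mul, Derivation.leibniz, hp, hX, smul_eq_mul, map_add, smul_add,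
      Finset.sum_add_distrib, Finset.mul_sum, mul_smul_comm]

/-- The pairing `P ⊗ Q ↦ Q(∂) P` is equivariant. -/
theorem diffOp_subst {A B : Matrix (Fin N) (Fin N) ℂ} (hBA : B * A = 1)
    (q p : MvPolynomial (Fin N) ℂ) :
    diffOp (subst B.transpose q) (subst A p) = subst A (diffOp q p) := by
  induction q using MvPolynomial.induction_on with
  | C a =>
    have h : (C a : MvPolynomial (Fin N) ℂ) = a • 1 := by rw [smul_eq_C_mul, mul_one]
    simp [h, diffOp_one]
  | add q r hq hr => simp only [map_add, LinearMap.add_apply, hq, hr]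
  | mul_X q j hq =>
    have h1 : subst B.transpose (q * X j) =
        ∑ i, B j i • (X i * subst B.transpose q) := by
      rw [map_mul, mul_comm]
      conv_lhs => enter [1]; rw [subst, aeval_X]
      simp only [Finset.sum_mul, smul_mul_assoc, Matrix.transpose_apply]
    rw [h1, map_sum, LinearMap.sum_apply, mul_comm q, diffOp_X_mul]
    simp only [map_smul, LinearMap.smul_apply, diffOp_X_mul, Module.End.mul_apply, hq]
    change ∑ i, B j i • pderiv i (subst A (diffOp q p)) = subst A (pderiv j (diffOp q p))
    simp only [pderiv_subst, Finset.smul_sum, smul_smul]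
    rw [Finset.sum_comm]
    simp only [← Finset.sum_smul]
    -- The transformation of ∂_j by B cancels the factor A produced by the chain rule.
    have h2 : ∀ a, ∑ i, B j i * A i a = (1 : Matrix (Fin N) (Fin N) ℂ) j a := fun a => by
      rw [← hBA, Matrix.mul_apply]
    simp only [h2, Matrix.one_apply, ite_smul, one_smul, zero_smul]
    simp

theorem symRep_coe {k : ℕ} (g : SL N) (p : SymPow N k) :
    (symRep N k g p : MvPolynomial (Fin N) ℂ) = subst g.1 p := rfl

theorem div_isIntertwiningMap (N k l : ℕ) :
    (tensorRep N k l).IsIntertwiningMap (symRep N (k - l)) (SLRep.div N k l) := by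
  constructor
  intro g v
  induction v with
  | zero => simp
  | add x y hx hy => simp only [map_add, hx, hy]
  | tmul p q =>
    apply Subtype.ext
    change diffOp (subst (g⁻¹ : SL N).1.transpose q.1) (subst g.1 p.1) = subst g.1 (diffOp q.1 p.1)
    refine diffOp_subst ?_ _ _
    rw [← Matrix.SpecialLinearGroup.coe_mul, inv_mul_cancel]
    rfl

end DiffOp

/-! ### The Fischer inner product and invariant complements -/

section Fischer

variable {N : ℕ}

/-- The weight `∏ m_i!` of a monomial in the Fischer inner product. -/
def factWeight (m : Fin N →₀ ℕ) : ℕ := ∏ i, (m i).factorial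

theorem factWeight_add_single (m : Fin N →₀ ℕ) (i : Fin N) :
    factWeight (Finsupp.single i 1 + m) = (m i + 1) * factWeight m := by
  unfold factWeight
  rw [← Finset.mul_prod_erase _ _ (Finset.mem_univ i),
    ← Finset.mul_prod_erase _ (fun j => (m j).factorial) (Finset.mem_univ i), ← mul_assoc]
  congr 1
  · rw [Finsupp.add_apply, Finsupp.single_eq_same, add_comm, Nat.factorial_succ]
  · refine Finset.prod_congr rfl fun j hj => ?_
    rw [Finsupp.add_apply, Finsupp.single_eq_of_ne (Finset.ne_of_mem_erase hj), zero_add]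

/-- This makes monomials orthogonal with positive norms, which gives symmetry and definiteness of
the Fischer product. It also supplies the nonvanishing of div. -/
theorem coeff_zero_diffOp_monomial (m : Fin N →₀ ℕ) (p : MvPolynomial (Fin N) ℂ) :
    coeff 0 (diffOp (monomial m 1) p) = factWeight m * coeff m p := by
  obtain ⟨n, hn⟩ : ∃ n, m.degree = n := ⟨_, rfl⟩
  induction n generalizing m p with
  | zero =>
    obtain rfl := (Finsupp.degree_eq_zero_iff m).1 hn
    have h : (monomial 0 1 : MvPolynomial (Fin N) ℂ) = 1 := rfl
    simp [h, diffOp_one, factWeight]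
  | succ n ih =>
    obtain ⟨i, hi⟩ : ∃ i, m i ≠ 0 := by
      by_contra! h
      have hm : m = 0 := Finsupp.ext h
      simp [hm] at hn
    obtain ⟨b, rfl⟩ : ∃ b, m = Finsupp.single i 1 + b :=
      ⟨m - Finsupp.single i 1, (add_tsub_cancel_of_le (Finsupp.single_le_iff.2
        (Nat.one_le_iff_ne_zero.2 hi))).symm⟩
    have hb : b.degree = n := by
      rw [map_add, Finsupp.degree_single] at hn
      omega
    have h1 : (monomial (Finsupp.single i 1 + b) 1 : MvPolynomial (Fin N) ℂ) =
        X i * monomial b 1 := by rw [X, monomial_mul, one_mul]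
    -- Commuting ∂_i to the right lets it act on `p` first, so the induction hypothesis applies to
    -- the derivative of `p`.
    rw [h1, diffOp_X_mul, diffOp_commute, Module.End.mul_apply, ih b _ hb,
      factWeight_add_single]
    change _ * coeff b (pderiv i p) = _
    rw [coeff_pderiv, add_comm b]
    push_cast
    ring

/-- The Fischer inner product, conjugate linear in the first variable. -/
def fischer {k : ℕ} (p q : SymPow N k) : ℂ :=
  coeff 0 (diffOp (MvPolynomial.map (starRingEnd ℂ) p.1) q.1)

theorem fischer_eq {k : ℕ} (p q : SymPow N k) :
    fischer p q = ∑ d ∈ (finite_degree_eq N k).toFinset,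
      (factWeight d : ℂ) * (starRingEnd ℂ (coeff d p.1) * coeff d q.1) := by
  have h : MvPolynomial.map (starRingEnd ℂ) p.1 = ∑ d ∈ (finite_degree_eq N k).toFinset,
      starRingEnd ℂ (coeff d p.1) • monomial d 1 := by
    have hp := congrArg (fun r : SymPow N k => MvPolynomial.map (starRingEnd ℂ) r.1)
      (sum_symMonomial p)
    simp only [AddSubmonoidClass.coe_finsetSum, map_sum, Submodule.coe_smul, symMonomial,
      smul_monomial, smul_eq_mul, mul_one, map_monomial] at hp
    rw [hp]
    simp only [smul_monomial, smul_eq_mul, mul_one]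
    exact Finset.sum_coe_sort (finite_degree_eq N k).toFinset
      fun d => monomial d (starRingEnd ℂ (coeff d p.1))
  rw [fischer, h, map_sum, LinearMap.sum_apply, coeff_sum]
  refine Finset.sum_congr rfl fun d _ => ?_
  rw [map_smul, LinearMap.smul_apply, coeff_smul, coeff_zero_diffOp_monomial, smul_eq_mul]
  ring

/-- The Fischer inner product space structure on `S^k`. -/
@[reducible]
def fischerCore (N k : ℕ) : InnerProductSpace.Core ℂ (SymPow N k) where
  inner := fischer
  conj_inner_symm p q := by
    simp only [fischer_eq, map_sum, map_mul, Complex.conj_conj, map_natCast]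
    exact Finset.sum_congr rfl fun d _ => by ring
  re_inner_nonneg p := by
    rw [fischer_eq, map_sum]
    refine Finset.sum_nonneg fun d _ => ?_
    rw [← Complex.normSq_eq_conj_mul_self]
    norm_cast
    exact mul_nonneg (Nat.cast_nonneg _) (Complex.normSq_nonneg _)
  add_left p q r := by
    simp [fischer]
  smul_left p q c := by
    simp [fischer_eq, Finset.mul_sum]
    exact Finset.sum_congr rfl fun d _ => by ring
  definite p hp := by
    rw [fischer_eq] at hp
    have h1 : ∑ d ∈ (finite_degree_eq N k).toFinset,
        (factWeight d : ℝ) * Complex.normSq (coeff d p.1) = 0 := by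
      refine Complex.ofReal_injective (Eq.trans ?_ (hp.trans Complex.ofReal_zero.symm))
      push_cast
      refine Finset.sum_congr rfl fun d _ => ?_
      rw [Complex.normSq_eq_conj_mul_self]
    rw [Finset.sum_eq_zero_iff_of_nonneg fun d _ =>
      mul_nonneg (Nat.cast_nonneg _) (Complex.normSq_nonneg _)] at h1
    apply Subtype.ext
    ext d
    rw [ZeroMemClass.coe_zero, coeff_zero]
    by_contra hd
    have h2 := h1 d ((finite_degree_eq N k).mem_toFinset.2
      (degree_eq_of_mem_support p.2 (mem_support_iff.2 hd)))
    have h3 : (factWeight d : ℝ) ≠ 0 :=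
      Nat.cast_ne_zero.2 (Finset.prod_ne_zero_iff.2 fun i _ => Nat.factorial_ne_zero _)
    exact hd (Complex.normSq_eq_zero.1 ((mul_eq_zero.1 h2).resolve_left h3))

theorem map_subst (A : Matrix (Fin N) (Fin N) ℂ) (p : MvPolynomial (Fin N) ℂ) :
    MvPolynomial.map (starRingEnd ℂ) (subst A p) =
      subst (A.map (starRingEnd ℂ)) (MvPolynomial.map (starRingEnd ℂ) p) := by
  induction p using MvPolynomial.induction_on with
  | C a => simp [subst, algHom_C, algebraMap_eq]
  | add p q hp hq => simp only [map_add, hp, hq]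
  | mul_X p j hp =>
    simp only [map_mul, hp, map_X]
    congr 1
    simp [subst, smul_eq_C_mul]

theorem coeff_zero_subst (A : Matrix (Fin N) (Fin N) ℂ) (p : MvPolynomial (Fin N) ℂ) :
    coeff 0 (subst A p) = coeff 0 p := by
  simp only [← constantCoeff_eq]
  induction p using MvPolynomial.induction_on with
  | C a => simp [subst]
  | add p q hp hq => simp only [map_add, hp, hq]
  | mul_X p j hp => simp [subst, smul_eq_C_mul]

/-- The conjugate transpose in `SL(N, ℂ)`. -/
def conjTr (g : SL N) : SL N :=
  ⟨g.1.conjTranspose, by rw [Matrix.det_conjTranspose, g.2, star_one]⟩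

theorem conjTr_conjTr (g : SL N) : conjTr (conjTr g) = g :=
  Subtype.ext (Matrix.conjTranspose_conjTranspose _)

/-- Write q as (g^*)⁻¹ applied to g^* q. By equivariance of Q(∂)P the pairing becomes a substitution
into p̄(∂)(g^* q), and a linear substitution does not change the constant term. -/
theorem fischer_symRep {k : ℕ} (g : SL N) (p q : SymPow N k) :
    fischer (symRep N k g p) q = fischer p (symRep N k (conjTr g) q) := by
  have h1 : q.1 = subst ((conjTr g)⁻¹ : SL N).1 (subst (conjTr g).1 q.1) := by
    rw [← AlgHom.comp_apply, ← subst_mul, ← Matrix.SpecialLinearGroup.coe_mul, inv_mul_cancel,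
      Matrix.SpecialLinearGroup.coe_one, subst_one, AlgHom.id_apply]
  have h2 : g.1.map (starRingEnd ℂ) = (conjTr g).1.transpose := by
    ext i j
    rfl
  rw [fischer, fischer, symRep_coe, symRep_coe, map_subst, h2]
  conv_lhs => rw [h1]
  rw [diffOp_subst, coeff_zero_subst]
  rw [← Matrix.SpecialLinearGroup.coe_mul, mul_inv_cancel, Matrix.SpecialLinearGroup.coe_one]

theorem symDualRep_eq {k : ℕ} (g : SL N) : symDualRep N k g = symRep N k (g⁻¹).transpose := rfl

theorem conjTr_inv_transpose (g : SL N) :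
    conjTr (g⁻¹).transpose = ((conjTr g)⁻¹).transpose := by
  have h : conjTr g⁻¹ = (conjTr g)⁻¹ := by
    rw [eq_inv_iff_mul_eq_one]
    apply Subtype.ext
    change (g⁻¹ : SL N).1.conjTranspose * g.1.conjTranspose = 1
    rw [← Matrix.conjTranspose_mul, ← Matrix.SpecialLinearGroup.coe_mul, mul_inv_cancel,
      Matrix.SpecialLinearGroup.coe_one, Matrix.conjTranspose_one]
  rw [← h]
  rfl

theorem fischer_symDualRep {k : ℕ} (g : SL N) (p q : SymPow N k) :
    fischer (symDualRep N k g p) q = fischer p (symDualRep N k (conjTr g) q) := by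
  rw [symDualRep_eq, symDualRep_eq, fischer_symRep, conjTr_inv_transpose]

section Orthogonal

/-- The norm of the Fischer inner product. -/
@[reducible]
def fischerNormedAddCommGroup (N k : ℕ) : NormedAddCommGroup (SymPow N k) :=
  (fischerCore N k).toNormedAddCommGroup

attribute [local instance] fischerNormedAddCommGroup

/-- The Fischer inner product space. -/
@[reducible]
def fischerInnerProductSpace (N k : ℕ) : InnerProductSpace ℂ (SymPow N k) :=
  InnerProductSpace.ofCore (fischerCore N k).toCore

attribute [local instance] fischerInnerProductSpace

theorem inner_tensorRep {k l : ℕ} (g : SL N) (x y : SymPow N k ⊗[ℂ] SymPow N l) :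
    inner ℂ (tensorRep N k l g x) y = inner ℂ x (tensorRep N k l (conjTr g) y) := by
  induction x with
  | zero => simp
  | add x x' hx hx' => rw [map_add, inner_add_left, inner_add_left, hx, hx']
  | tmul p q =>
    induction y with
    | zero => simp
    | add y y' hy hy' => rw [map_add, inner_add_right, inner_add_right, hy, hy']
    | tmul p' q' =>
      simp only [tensorRep, Representation.tprod_apply, TensorProduct.map_tmul,
        TensorProduct.inner_tmul]
      congr 1
      · exact fischer_symRep g p p'
      · exact fischer_symDualRep g q q'

/-- An invariant notion of orthogonal complement on `S^k ⊗ S^l^*`. -/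
theorem exists_orthogonal (N k l : ℕ) :
    ∃ perp : Submodule ℂ (SymPow N k ⊗[ℂ] SymPow N l) →
        Submodule ℂ (SymPow N k ⊗[ℂ] SymPow N l),
      (∀ U, IsCompl U (perp U)) ∧ (∀ U, perp (perp U) = U) ∧
      ∀ U, (∀ g, ∀ v ∈ U, tensorRep N k l g v ∈ U) →
        ∀ g, ∀ v ∈ perp U, tensorRep N k l g v ∈ perp U := by
  refine ⟨fun U => Uᗮ, fun U => U.isCompl_orthogonal,
    fun U => U.orthogonal_orthogonal, fun U hU g v hv => ?_⟩
  rw [Submodule.mem_orthogonal] at hv ⊢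
  intro u hu
  -- The adjoint of `g` acts as the group element `conjTr g`, which preserves U.
  rw [← conjTr_conjTr g, ← inner_tensorRep]
  exact hv _ (hU _ _ hu)

end Orthogonal

end Fischer

/-! ### Equivariant maps from S^k ⊗ (S^l)^* to S^m -/

section Hom

variable {N k l m : ℕ}

theorem diffOp_X_pow_mul (i : Fin N) (n : ℕ) (q : MvPolynomial (Fin N) ℂ) :
    diffOp (X i ^ n * q) = pd i ^ n * diffOp q := by
  induction n with
  | zero => simp
  | succ n ih => rw [pow_succ', mul_assoc, diffOp_X_mul, ih, pow_succ', mul_assoc]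

/-- If ∂_z^l killed x_z^k, so would ∂_z^k, whereas ∂_z^k x_z^k = k!. -/
theorem div_ne_zero (hN : 2 ≤ N) (hkl : l ≤ k) : SLRep.div N k l ≠ 0 := by
  intro h
  let z : Fin N := ⟨0, by omega⟩
  have h1 : SLRep.div N k l (symMonomial (Finsupp.single z k) (Finsupp.degree_single _ _) ⊗ₜ
      symMonomial (Finsupp.single z l) (Finsupp.degree_single _ _)) = 0 := by rw [h]; rfl
  have h2 : diffOp (monomial (Finsupp.single z l) (1 : ℂ)) (monomial (Finsupp.single z k) 1) = 0 :=
    congrArg Subtype.val h1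
  have h3 : (monomial (Finsupp.single z k) 1 : MvPolynomial (Fin N) ℂ) =
      X z ^ (k - l) * monomial (Finsupp.single z l) 1 := by
    rw [X_pow_eq_monomial, monomial_mul, ← Finsupp.single_add, Nat.sub_add_cancel hkl, one_mul]
  have h4 := coeff_zero_diffOp_monomial (Finsupp.single z k) (monomial (Finsupp.single z k) (1 : ℂ))
  conv_lhs at h4 => rw [h3]
  rw [diffOp_X_pow_mul, Module.End.mul_apply, ← h3, h2, map_zero, coeff_zero, coeff_monomial,
    if_pos rfl, mul_one] at h4
  exact Nat.cast_ne_zero.2 (Finset.prod_ne_zero_iff.2 fun i _ => Nat.factorial_ne_zero _) h4.symm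

variable (T : (tensorRep N k l).IntertwiningMap (symRep N m))

theorem intertwining_tmul {γ : ℂ → SL N} {A : Matrix (Fin N) (Fin N) ℂ} (h : IsOneParam γ A)
    (p : SymPow N k) (q : SymPow N l) :
    T (symDer N k A p ⊗ₜ q) + T (p ⊗ₜ symDer N l (-A.transpose) q) =
      symDer N m A (T (p ⊗ₜ q)) := by
  rw [← HasDiff.intertwine (V := SymPow N k ⊗[ℂ] SymPow N l) (tensorRep_hasDiff h)
    (symRep_hasDiff h) T, ← map_add]
  rfl

theorem symDer_neg (A : Matrix (Fin N) (Fin N) ℂ) : symDer N k (-A) = (-1 : ℂ) • symDer N k A := by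
  apply LinearMap.ext
  intro p
  apply Subtype.ext
  rw [LinearMap.smul_apply, Submodule.coe_smul, symDer_coe, symDer_coe, ← neg_one_smul ℂ A,
    linDer_smul, Derivation.smul_apply]

/-- The coefficient of `x_z^m` in the image of a tensor of monomials. -/
def topCoeff (z : Fin N) (v : SymPow N k ⊗[ℂ] SymPow N l) : ℂ :=
  coeff (Finsupp.single z m) (T v).1

/-- Comparing weights for traceless diagonal matrices shows only that a - b - m e_z is a constant
vector; its entries sum to k - l - m = 0, so the constant is zero. -/
theorem topCoeff_weight (z : Fin N) {a b : Fin N →₀ ℕ} (ha : a.degree = k) (hb : b.degree = l)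
    (hklm : k = m + l)
    (h : topCoeff T z (symMonomial a ha ⊗ₜ symMonomial b hb) ≠ 0) :
    a = b + Finsupp.single z m := by
  have hw : ∀ v : Fin N → ℂ, ∑ i, v i = 0 → ∑ i, v i * a i - ∑ i, v i * b i = v z * m := by
    intro v hv
    obtain ⟨γ, hγ⟩ := exists_oneParam_diagonal v hv
    have h1 := intertwining_tmul T hγ (symMonomial a ha) (symMonomial b hb)
    rw [Matrix.diagonal_transpose, symDer_neg, LinearMap.smul_apply, symDer_diagonal_symMonomial,
      symDer_diagonal_symMonomial, tmul_smul, tmul_smul, ← smul_tmul', map_smul, map_smul,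
      map_smul] at h1
    have h2 := congrArg (fun q : SymPow N m => coeff (Finsupp.single z m) q.1) h1
    have h3 : ∀ p : MvPolynomial (Fin N) ℂ, coeff (Finsupp.single z m) (linDer (Matrix.diagonal v) p)
        = v z * m * coeff (Finsupp.single z m) p := by
      intro p
      induction p using MvPolynomial.induction_on' with
      | monomial u c =>
        rw [linDer_diagonal_monomial, coeff_smul, coeff_monomial]
        split_ifs with hu
        · subst hu
          rw [Finset.sum_eq_single z]
          · simp
          · intro j _ hj; simp [Finsupp.single_eq_of_ne hj]
          · simp
        · simp
      | add p q hp hq => rw [map_add, coeff_add, hp, hq, coeff_add, mul_add]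
    simp only [Submodule.coe_add, Submodule.coe_smul, coeff_add,
      coeff_smul, symDer_coe, h3, smul_eq_mul] at h2
    refine mul_right_cancel₀ h ?_
    unfold topCoeff
    linear_combination h2
  have hsum : ∑ i, ((a i : ℂ) - b i) = m := by
    rw [Finset.sum_sub_distrib]
    rw [Finsupp.degree_eq_sum] at ha hb
    have h1 : ((∑ i, a i : ℕ) : ℂ) = m + ((∑ i, b i : ℕ) : ℂ) := by
      rw [ha, hb, hklm]; push_cast; ring
    push_cast at h1
    rw [h1]
    ring
  have hne : ∀ i, i ≠ z → (a i : ℂ) - b i = (a z - b z) - m := by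
    intro i hi
    -- The coroots e_i - e_z compare each entry with the one at `z`.
    have h1 := hw (Pi.single i 1 - Pi.single z 1) (by simp)
    simp only [Pi.sub_apply, sub_mul, Finset.sum_sub_distrib, Pi.single_apply, ite_mul, one_mul,
      zero_mul, Finset.sum_ite_eq', Finset.mem_univ, if_true, if_neg hi.symm] at h1
    linear_combination h1
  have hz : (a z : ℂ) - b z = m := by
    have hN : (N : ℂ) ≠ 0 := Nat.cast_ne_zero.2 (Fin.pos z).ne'
    rw [← Finset.add_sum_erase _ _ (Finset.mem_univ z),
      Finset.sum_congr rfl fun i hi => hne i (Finset.ne_of_mem_erase hi), Finset.sum_const,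
      Finset.card_erase_of_mem (Finset.mem_univ z), Finset.card_univ, Fintype.card_fin,
      nsmul_eq_mul, Nat.cast_pred (Fin.pos z)] at hsum
    have : (N : ℂ) * ((a z : ℂ) - b z - m) = 0 := by linear_combination hsum
    exact sub_eq_zero.1 ((mul_eq_zero.1 this).resolve_left hN)
  ext i
  rw [Finsupp.add_apply, Finsupp.single_apply]
  split_ifs with hi
  · subst hi
    have : (a z : ℂ) = ((b z + m : ℕ) : ℂ) := by push_cast; linear_combination hz
    exact_mod_cast this
  · have h1 := hne i (Ne.symm hi)
    rw [hz, sub_self] at h1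
    have : (a i : ℂ) = ((b i : ℕ) : ℂ) := by linear_combination h1
    exact_mod_cast this

/-- Apply the equivariance under E_iz to x^c x_z ⊗ ∂^d ∂_i. The right side lies in the image of x_i
∂_z and has no x_z^m term, so the two Leibniz terms on the left cancel in that coefficient. -/
theorem topCoeff_exchange {i z : Fin N} (hi : i ≠ z) (c d : Fin N →₀ ℕ)
    (hci : (c + Finsupp.single i 1).degree = k) (hcz : (c + Finsupp.single z 1).degree = k)
    (hdi : (d + Finsupp.single i 1).degree = l) (hdz : (d + Finsupp.single z 1).degree = l) :
    ((c z : ℂ) + 1) * topCoeff T z (symMonomial _ hci ⊗ₜ symMonomial _ hdi) =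
      ((d i : ℂ) + 1) * topCoeff T z (symMonomial _ hcz ⊗ₜ symMonomial _ hdz) := by
  obtain ⟨γ, hγ⟩ := exists_oneParam_single hi 1
  have h1 := intertwining_tmul T hγ (symMonomial _ hcz) (symMonomial _ hdi)
  rw [Matrix.transpose_single, symDer_neg, LinearMap.smul_apply,
    symDer_single_symMonomial i z c hcz hci, symDer_single_symMonomial z i d hdi hdz,
    tmul_smul, tmul_smul, ← smul_tmul', map_smul, map_smul, map_smul] at h1
  have h2 := congrArg (fun q : SymPow N m => coeff (Finsupp.single z m) q.1) h1
  have h3 : i ∉ (Finsupp.single z m).support := fun h => hi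
    (Finset.mem_singleton.1 (Finsupp.support_single_subset h))
  simp only [Submodule.coe_add, Submodule.coe_smul, coeff_add,
    coeff_smul, symDer_coe, linDer_single, coeff_X_mul', if_neg h3, smul_eq_mul] at h2
  unfold topCoeff
  linear_combination h2

/-- On tensors of monomials, induct on a bound for l - b_z: the weight condition leaves a = b + m
e_z, and the exchange relation trades a common index i ≠ z of a and b for z. -/
theorem topCoeff_eq_zero (z : Fin N) (hklm : k = m + l)
    (h : topCoeff T z (symMonomial (Finsupp.single z k) (Finsupp.degree_single _ _) ⊗ₜ
      symMonomial (Finsupp.single z l) (Finsupp.degree_single _ _)) = 0)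
    (v : SymPow N k ⊗[ℂ] SymPow N l) : topCoeff T z v = 0 := by
  have hmon : ∀ n, ∀ a b (ha : a.degree = k) (hb : b.degree = l), l ≤ b z + n →
      topCoeff T z (symMonomial a ha ⊗ₜ symMonomial b hb) = 0 := by
    intro n
    induction n with
    | zero =>
      intro a b ha hb hn
      by_contra hne
      obtain rfl := topCoeff_weight T z ha hb hklm hne
      obtain rfl := eq_single_of_degree hb z hn
      apply hne
      convert h using 5
      rw [← Finsupp.single_add, hklm, add_comm]
    | succ n ih =>
      intro a b ha hb hn
      by_cases hbl : l ≤ b z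
      · exact ih a b ha hb (by omega)
      by_contra hne
      obtain rfl := topCoeff_weight T z ha hb hklm hne
      obtain ⟨i, d, hi, rfl⟩ := exists_add_single_of_degree hb z (by omega)
      have hcomm : d + Finsupp.single i 1 + Finsupp.single z m =
        d + Finsupp.single z m + Finsupp.single i 1 := add_right_comm _ _ _
      have hdz : (d + Finsupp.single z 1).degree = l := by
        rw [← hb, map_add, map_add, Finsupp.degree_single, Finsupp.degree_single]
      have hcz : (d + Finsupp.single z m + Finsupp.single z 1).degree = k := by
        rw [← ha, hcomm, map_add, map_add _ _ (Finsupp.single i 1), Finsupp.degree_single,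
          Finsupp.degree_single]
      have hci : (d + Finsupp.single z m + Finsupp.single i 1).degree = k := by rw [← hcomm, ha]
      have h1 := topCoeff_exchange T hi (d + Finsupp.single z m) d hci hcz hb hdz
      rw [ih _ _ hcz hdz (by simp [hi.symm] at hn ⊢; omega), mul_zero] at h1
      apply hne
      have h2 := (mul_eq_zero.1 h1).resolve_left (Nat.cast_add_one_ne_zero _)
      convert h2 using 5
  let L : SymPow N k ⊗[ℂ] SymPow N l →ₗ[ℂ] ℂ :=
    (lcoeff ℂ (Finsupp.single z m)).comp ((SymPow N m).subtype.comp T.toLinearMap)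
  have hL : L = 0 := by
    apply TensorProduct.ext'
    intro p q
    have hq : ∀ a (ha : a.degree = k), L (symMonomial a ha ⊗ₜ q) = 0 := by
      intro a ha
      have := span_symMonomial (U := LinearMap.ker (L.comp (TensorProduct.mk ℂ _ _
        (symMonomial a ha)))) fun b hb => hmon l a b ha hb (by omega)
      exact LinearMap.mem_ker.1 (this ▸ Submodule.mem_top : q ∈ _)
    have := span_symMonomial (U := LinearMap.ker (L.comp ((TensorProduct.mk ℂ _ _).flip q)))
      fun a ha => hq a ha
    exact LinearMap.mem_ker.1 (this ▸ Submodule.mem_top : p ∈ _)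
  exact LinearMap.congr_fun hL v

theorem intertwining_eq_zero (hN : 2 ≤ N) (z : Fin N) (hklm : k = m + l)
    (h : topCoeff T z (symMonomial (Finsupp.single z k) (Finsupp.degree_single _ _) ⊗ₜ
      symMonomial (Finsupp.single z l) (Finsupp.degree_single _ _)) = 0) : T = 0 := by
  by_contra hT
  have hirr := symRep_isIrreducible hN m
  rcases Representation.IsIrreducible.surjective_or_eq_zero
      (W := SymPow N k ⊗[ℂ] SymPow N l) T with hs | hs
  · obtain ⟨v, hv⟩ := hs (symMonomial (Finsupp.single z m) (Finsupp.degree_single _ _))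
    have h1 := topCoeff_eq_zero T z hklm h v
    rw [topCoeff, hv] at h1
    simp [symMonomial] at h1
  · exact hT hs

/-- `div` as an intertwining map. -/
def divHom (N k l : ℕ) : (tensorRep N k l).IntertwiningMap (symRep N (k - l)) :=
  ⟨SLRep.div N k l, fun g => LinearMap.ext fun v =>
    (div_isIntertwiningMap N k l).isIntertwining g v⟩

theorem divHom_ne_zero (hN : 2 ≤ N) (hkl : l ≤ k) : divHom N k l ≠ 0 := fun h =>
  div_ne_zero hN hkl (congrArg Representation.IntertwiningMap.toLinearMap h)

/-- Subtract from T the multiple of div with the same value of `topCoeff` on x_z^k ⊗ ∂_z^l; the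
difference is zero. -/
theorem exists_eq_smul_divHom (hN : 2 ≤ N) (hkl : l ≤ k)
    (T : (tensorRep N k l).IntertwiningMap (symRep N (k - l))) : ∃ c : ℂ, c • divHom N k l = T := by
  let z : Fin N := ⟨0, by omega⟩
  let v : SymPow N k ⊗[ℂ] SymPow N l :=
    symMonomial (Finsupp.single z k) (Finsupp.degree_single _ _) ⊗ₜ
      symMonomial (Finsupp.single z l) (Finsupp.degree_single _ _)
  have hklm : k = (k - l) + l := (Nat.sub_add_cancel hkl).symm
  have hd : topCoeff (divHom N k l) z v ≠ 0 := fun h =>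
    divHom_ne_zero hN hkl (intertwining_eq_zero _ hN z hklm h)
  refine ⟨topCoeff T z v / topCoeff (divHom N k l) z v, ?_⟩
  rw [← sub_eq_zero]
  refine intertwining_eq_zero _ hN z hklm ?_
  change coeff _ ((topCoeff T z v / topCoeff (divHom N k l) z v) • (divHom N k l v).1 - (T v).1) = 0
  rw [coeff_sub, coeff_smul, smul_eq_mul, sub_eq_zero]
  exact div_mul_cancel₀ _ hd

end Hom

/-! ### Isotypic components when the Hom space is a line -/

section Isotypic

variable {G : Type*} [Group G] {M V : Type*} [AddCommGroup M] [Module ℂ M]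
  [AddCommGroup V] [Module ℂ V] {τ : Representation ℂ G M} {σ : Representation ℂ G V}
  {d : τ.IntertwiningMap σ} {perp : Submodule ℂ M → Submodule ℂ M}

theorem perp_ker_bijective [σ.IsIrreducible] (hd : d ≠ 0)
    (hc : ∀ U, IsCompl U (perp U)) :
    Function.Bijective (d.toLinearMap.domRestrict (perp (LinearMap.ker d.toLinearMap))) := by
  have hcd := hc (LinearMap.ker d.toLinearMap)
  constructor
  · rw [injective_iff_map_eq_zero]
    rintro ⟨v, hv⟩ hv0
    exact Subtype.ext (Submodule.disjoint_def.1 hcd.disjoint v (LinearMap.mem_ker.2 hv0) hv)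
  · intro w
    obtain ⟨v, rfl⟩ := (Representation.IsIrreducible.surjective_or_eq_zero d).resolve_right hd w
    obtain ⟨a, ha, b, hb, rfl⟩ := Submodule.mem_sup.1
      (hcd.sup_eq_top ▸ Submodule.mem_top : v ∈ LinearMap.ker d.toLinearMap ⊔ _)
    refine ⟨⟨b, hb⟩, ?_⟩
    have h1 : d a = 0 := LinearMap.mem_ker.1 ha
    rw [map_add, h1, zero_add]
    rfl

/-- If every intertwining map `τ → σ` is a multiple of `d`, the `σ`-isotypic component is the
complement of the kernel of `d`. -/
theorem isotypic_eq_perp_ker [σ.IsIrreducible] (hd : d ≠ 0)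
    (hmul : ∀ T : τ.IntertwiningMap σ, ∃ c : ℂ, c • d = T)
    (hc : ∀ U, IsCompl U (perp U)) (hpp : ∀ U, perp (perp U) = U)
    (hinv : ∀ U, (∀ g, ∀ v ∈ U, τ g v ∈ U) → ∀ g, ∀ v ∈ perp U, τ g v ∈ perp U) :
    isotypic τ σ = perp (LinearMap.ker d.toLinearMap) := by
  refine le_antisymm (iSup₂_le fun U hU => ?_) ?_
  · obtain ⟨e⟩ := hU
    have hinvU := hinv U.toSubmodule fun g v hv => U.apply_mem_toSubmodule g hv
    have hcU := hc U.toSubmodule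
    let P := Submodule.projectionOnto _ _ hcU
    -- The projection onto U along its invariant complement is equivariant, so with `e` it gives a
    -- map to σ, hence a multiple of `d`.
    let T : τ.IntertwiningMap σ := ⟨e.toLinearMap ∘ₗ P, fun g => LinearMap.ext fun v => by
      obtain ⟨a, ha, b, hb, rfl⟩ := Submodule.mem_sup.1
        (hcU.sup_eq_top ▸ Submodule.mem_top : v ∈ U.toSubmodule ⊔ _)
      have h1 : P (τ g (a + b)) = U.toRepresentation g (P (a + b)) := by
        rw [map_add, map_add, map_add]
        have h2 : P b = 0 := (Submodule.projectionOnto_apply_eq_zero_iff hcU).2 hb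
        have h3 : P (τ g b) = 0 :=
          (Submodule.projectionOnto_apply_eq_zero_iff hcU).2 (hinvU g b hb)
        have h4 : P a = ⟨a, ha⟩ := Submodule.projectionOnto_apply_of_mem_left hcU ha
        have h5 : P (τ g a) = ⟨τ g a, U.apply_mem_toSubmodule g ha⟩ :=
          Submodule.projectionOnto_apply_of_mem_left hcU _
        rw [h2, h3, h4, h5, add_zero, add_zero]
        rfl
      change e (P (τ g (a + b))) = σ g (e (P (a + b)))
      rw [h1]
      exact e.toIntertwiningMap.isIntertwining _ _ g _⟩
    have hT : ∀ v, T v = e (P v) := fun _ => rfl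
    obtain ⟨c, hcT⟩ := hmul T
    have hker : LinearMap.ker d.toLinearMap = perp U.toSubmodule := by
      ext v
      rw [← Submodule.projectionOnto_apply_eq_zero_iff hcU]
      have hv : c • d v = e (P v) := by rw [← hT, ← hcT]; rfl
      have hiff : e (P v) = 0 ↔ P v = 0 := map_eq_zero_iff e e.injective
      -- T is onto and σ is nonzero, so c ≠ 0 and T has the same kernel as `d`. Thus ker d = perp U,
      -- and U = perp (ker d) for every copy U of σ.
      have hc0 : c ≠ 0 := by
        rintro rfl
        obtain ⟨w, hw⟩ : ∃ w, d w ≠ 0 := by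
          by_contra! h
          exact hd (Representation.IntertwiningMap.ext (LinearMap.ext h))
        obtain ⟨y, hy⟩ := Submodule.projectionOnto_surjective hcU (e.symm (d w))
        have h1 : T y = 0 := by rw [← hcT]; exact zero_smul ℂ _
        rw [hT] at h1
        change e (Submodule.projectionOnto _ _ hcU y) = 0 at h1
        rw [hy, Representation.Equiv.apply_symm_apply] at h1
        exact hw h1
      rw [LinearMap.mem_ker]
      change d v = 0 ↔ P v = 0
      rw [← hiff, ← hv, smul_eq_zero]
      simp [hc0]
    rw [hker, hpp]
  · have hinvd := hinv (LinearMap.ker d.toLinearMap) fun g v (hv : d v = 0) =>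
      LinearMap.mem_ker.2 (show d (τ g v) = 0 by rw [d.isIntertwining, hv, map_zero])
    let U : Subrepresentation τ := ⟨perp (LinearMap.ker d.toLinearMap), fun g v hv => hinvd g v hv⟩
    refine le_iSup₂_of_le U ⟨?_⟩ le_rfl
    exact Representation.Equiv.mk (LinearEquiv.ofBijective _ (perp_ker_bijective hd hc))
      fun g => LinearMap.ext fun v => d.isIntertwining _ _ g v.1

theorem isotypic_congr {V' : Type*} [AddCommGroup V'] [Module ℂ V'] {σ' : Representation ℂ G V'}
    (e : σ.Equiv σ') : isotypic τ σ = isotypic τ σ' := by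
  unfold isotypic
  have h : ∀ U : Subrepresentation τ, Nonempty (U.toRepresentation.Equiv σ) ↔
      Nonempty (U.toRepresentation.Equiv σ') := fun U =>
    ⟨fun ⟨f⟩ => ⟨f.trans e⟩, fun ⟨f⟩ => ⟨f.trans e.symm⟩⟩
  simp only [h]

/-- Restricted to a copy of π, `d` is an intertwining map between inequivalent irreducible
representations, hence zero by Schur's lemma. -/
theorem isotypic_le_ker {W : Type*} [AddCommGroup W] [Module ℂ W] {π : Representation ℂ G W}
    [σ.IsIrreducible] [π.IsIrreducible] (h : IsEmpty (π.Equiv σ)) :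
    isotypic τ π ≤ LinearMap.ker d.toLinearMap := by
  refine iSup₂_le fun U ⟨e⟩ => ?_
  let ι : U.toRepresentation.IntertwiningMap τ := ⟨U.toSubmodule.subtype, fun g => rfl⟩
  have h0 := Subsingleton.elim ((d.comp ι).comp e.symm.toIntertwiningMap) 0
  intro v hv
  have h1 : (d.comp ι) (e.symm (e ⟨v, hv⟩)) = 0 := DFunLike.congr_fun h0 (e ⟨v, hv⟩)
  rw [Representation.Equiv.symm_apply_apply] at h1
  exact h1

theorem multiplicity_eq_one {V' : Type*} [AddCommGroup V'] [Module ℂ V']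
    {σ' : Representation ℂ G V'} (e : σ.Equiv σ') (hd : d ≠ 0)
    (hmul : ∀ T : τ.IntertwiningMap σ, ∃ c : ℂ, c • d = T) : multiplicity τ σ' = 1 := by
  refine finrank_eq_one (e.toIntertwiningMap.comp d) (fun h => hd ?_) fun T => ?_
  · ext v
    have h1 : e (d v) = 0 := DFunLike.congr_fun h v
    exact (map_eq_zero_iff e e.injective).1 h1
  · obtain ⟨c, hc⟩ := hmul (e.symm.toIntertwiningMap.comp T)
    refine ⟨c, ?_⟩
    ext v
    have h1 : c • d v = e.symm (T v) := DFunLike.congr_fun hc v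
    change c • e (d v) = T v
    rw [← map_smul, h1, Representation.Equiv.apply_symm_apply]

theorem complementedLattice_of_perp (hc : ∀ U, IsCompl U (perp U))
    (hinv : ∀ U, (∀ g, ∀ v ∈ U, τ g v ∈ U) → ∀ g, ∀ v ∈ perp U, τ g v ∈ perp U) :
    ComplementedLattice (Subrepresentation τ) where
  exists_isCompl U := by
    refine ⟨⟨perp U.toSubmodule, fun g v hv =>
      hinv _ (fun g v hv => U.apply_mem_toSubmodule g hv) g v hv⟩, ?_⟩
    have h := hc U.toSubmodule
    rw [isCompl_iff, disjoint_iff, codisjoint_iff] at h ⊢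
    exact ⟨Subrepresentation.toSubmodule_injective h.1,
      Subrepresentation.toSubmodule_injective h.2⟩

end Isotypic

end SLRep

end

/-! ### Assembly: transfer from S^(k-l) to an arbitrary model -/

open SLRep in
theorem mainTheorem9 (N k l : ℕ) (hN : 2 ≤ N) (hkl : l ≤ k) :
    IsHighestWeightRep (symRep N (k - l)) ((k - l) • fundamentalWeight N 1) ∧
    ComplementedLattice (Subrepresentation (tensorRep N k l)) ∧
    (tensorRep N k l).IsIntertwiningMap (symRep N (k - l)) (SLRep.div N k l) ∧
    ∀ (V : Type*) [AddCommGroup V] [Module ℂ V] (ρ : Representation ℂ (SL N) V),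
      IsHighestWeightRep ρ ((k - l) • fundamentalWeight N 1) →
        SLRep.multiplicity (tensorRep N k l) ρ = 1 ∧
        Function.Bijective
          ((SLRep.div N k l).domRestrict (isotypic (tensorRep N k l) ρ)) ∧
        ∀ (W : Type*) [AddCommGroup W] [Module ℂ W] (σ : Representation ℂ (SL N) W),
          σ.IsIrreducible → IsEmpty (σ.Equiv ρ) →
            ∀ x ∈ isotypic (tensorRep N k l) σ, SLRep.div N k l x = 0 := by
  obtain ⟨perp, hc, hpp, hinv⟩ := exists_orthogonal N k l
  have hd := divHom_ne_zero hN hkl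
  have hmul := exists_eq_smul_divHom hN hkl
  have hirr := symRep_isIrreducible hN (k - l)
  refine ⟨symRep_isHighestWeightRep hN _,
    complementedLattice_of_perp (M := TensorProduct ℂ (SymPow N k) (SymPow N l)) hc hinv,
    div_isIntertwiningMap N k l, fun V _ _ ρ hρ => ?_⟩
  obtain ⟨e⟩ := (symRep_isHighestWeightRep hN (k - l)).equiv hN hρ
  refine ⟨multiplicity_eq_one (M := TensorProduct ℂ (SymPow N k) (SymPow N l)) e hd hmul, ?_,
    fun W _ _ σ hσ hemp x hx => ?_⟩
  · have h := isotypic_congr (M := TensorProduct ℂ (SymPow N k) (SymPow N l)) (τ := tensorRep N k l) e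
    have h2 := isotypic_eq_perp_ker (M := TensorProduct ℂ (SymPow N k) (SymPow N l)) hd hmul hc hpp hinv
    rw [← h, h2]
    exact perp_ker_bijective (M := TensorProduct ℂ (SymPow N k) (SymPow N l)) hd hc
  · have hemp' : IsEmpty (σ.Equiv (symRep N (k - l))) := ⟨fun f => hemp.elim (f.trans e)⟩
    exact isotypic_le_ker (M := TensorProduct ℂ (SymPow N k) (SymPow N l)) (d := divHom N k l) hemp' hx
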